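/- Let $n,m\in\mathbb{Z}$ with $2\leq n\leq |m|$, let $\Gamma=\operatorname{BS}(n,m)=\langle a,b\mid ba^nb^{-1}=a^m\rangle$, and for $g\in\Gamma$ put $l(g)=[\langle a\rangle:\langle a\rangle\cap g^{-1}\langle a\rangle g]$. Let $(P,\tau)$ be a tracial von Neumann algebra, i.e. a von Neumann algebra with a faithful normal tracial state, and let $\Gamma\curvearrowright P$ be a trace preserving action by $*$-automorphisms such that, for every $g\in\Gamma$, the inclusion $P\rtimes\langle a^{l(g)}\rangle\subset P\rtimes\Gamma$ is irreducible, i.e. $(P\rtimes\langle a^{l(g)}\rangle)'\cap(P\rtimes\Gamma)=\mathbb{C}1$. Write $M:=P\rtimes\Gamma$, with its canonical faithful normal trace and canonical unitaries $(u_g)_{g\in\Gamma}$, and $N:=P\rtimes\langle a\rangle\subset M$. For $g\in\Gamma$ let $\mathcal{K}_g:=\overline{\operatorname{span}}^{\|\cdot\|_2}\,Nu_gN\subset L^2(M)$, regarded as an $N$-$N$-bimodule. Then 1. for every $g\in\Gamma$ the $N$-$N$-bimodule $\mathcal{K}_g$ is irreducible, i.e. it is nonzero and its only closed $N$-$N$-subbimodules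 are $\{0\}$ and $\mathcal{K}_g$; 2. for all $g,h\in\Gamma$, the $N$-$N$-bimodules $\mathcal{K}_g$ and $\mathcal{K}_h$ are isomorphic (there is a unitary $\mathcal{K}_g\to\mathcal{K}_h$ commuting with the left and right actions of $N$) if and only if $\langle a\rangle g\langle a\rangle=\langle a\rangle h\langle a\rangle$. -/

import Mathlib

open scoped ComplexOrder InnerProductSpace ENNReal

noncomputable section

universe u v

/-! ## The von Neumann algebra generated by a set of operators -/

namespace VonNeumannAlgebra

variable {H : Type u} [NormedAddCommGroup H] [InnerProductSpace ℂ H] [CompleteSpace H]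

/-- The von Neumann algebra generated by a set `S` of bounded operators: the double commutant of
`S ∪ S*` (`StarSubalgebra.centralizer` is the commutant of a set together with its adjoints). -/
def generatedBy (S : Set (H →L[ℂ] H)) : VonNeumannAlgebra H :=
  commutant
    { toStarSubalgebra := StarSubalgebra.centralizer ℂ S
      centralizer_centralizer' := by simp }

theorem mem_generatedBy_iff {S : Set (H →L[ℂ] H)} {x : H →L[ℂ] H} :
    x ∈ generatedBy S ↔ ∀ y : H →L[ℂ] H,
      (∀ s ∈ S, s * y = y * s ∧ star s * y = y * star s) → y * x = x * y := by
  unfold generatedBy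
  rw [mem_commutant_iff]
  exact forall_congr' fun y => imp_congr_left (StarSubalgebra.mem_centralizer_iff ℂ)

theorem subset_generatedBy (S : Set (H →L[ℂ] H)) {x : H →L[ℂ] H} (hx : x ∈ S) :
    x ∈ generatedBy S :=
  mem_generatedBy_iff.2 fun _ hy => (hy x hx).1.symm

theorem generatedBy_mono {S T : Set (H →L[ℂ] H)} (h : S ⊆ T) : generatedBy S ≤ generatedBy T :=
  fun _ hx => mem_generatedBy_iff.2 fun y hy => mem_generatedBy_iff.1 hx y fun s hs => hy s (h hs)

/-- An inclusion `A ⊆ B` of von Neumann algebras is irreducible if the relative commutant of `A` in `B` is `ℂ 1`. -/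
def IsIrreducibleIn (A B : VonNeumannAlgebra H) : Prop :=
  A ≤ B ∧ ∀ x ∈ B, (∀ a ∈ A, a * x = x * a) → ∃ c : ℂ, x = c • 1

end VonNeumannAlgebra

/-! ## Tracial von Neumann algebras and their standard bimodule -/

/-- A von Neumann algebra on `H` equipped with a faithful normal tracial state. Normality is
`σ`-weak continuity, i.e. `τ = ∑ ⟪η i, · ξ i⟫` for square summable sequences of vectors. -/
structure TracialVNA (H : Type u) [NormedAddCommGroup H] [InnerProductSpace ℂ H]
    [CompleteSpace H] where
  alg : VonNeumannAlgebra H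
  trace : alg.toStarSubalgebra →ₗ[ℂ] ℂ
  trace_one : trace 1 = 1
  trace_nonneg : ∀ x, 0 ≤ trace (star x * x)
  faithful : ∀ x, trace (star x * x) = 0 → x = 0
  tracial : ∀ x y, trace (x * y) = trace (y * x)
  normal : ∃ ξ η : ℕ → H, (Summable fun i => ‖ξ i‖ ^ 2) ∧ (Summable fun i => ‖η i‖ ^ 2) ∧
    ∀ x : alg.toStarSubalgebra,
      HasSum (fun i => ⟪η i, (x : H →L[ℂ] H) (ξ i)⟫_ℂ) (trace x)

theorem exists_sub_eq_star_mul_self {A : Type u} [CStarAlgebra A] (x : A) :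
    ∃ z : A, ((‖x‖ ^ 2 : ℝ) : ℂ) • (1 : A) - star x * x = star z * z := by
  let _ : PartialOrder A := CStarAlgebra.spectralOrder A
  have : StarOrderedRing A := CStarAlgebra.spectralOrderedRing A
  have h := CStarAlgebra.star_mul_le_algebraMap_norm_sq (a := x)
  obtain ⟨z, hz⟩ := CStarAlgebra.nonneg_iff_eq_star_mul_self.1 (sub_nonneg.2 h)
  refine ⟨z, ?_⟩
  rw [← hz, Algebra.algebraMap_eq_smul_one, Complex.coe_smul]

namespace TracialVNA

variable {H : Type u} [NormedAddCommGroup H] [InnerProductSpace ℂ H] [CompleteSpace H]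
variable (T : TracialVNA H)

/-- The elements of a tracial von Neumann algebra. -/
abbrev Elt : Type u := T.alg.toStarSubalgebra

theorem isClosed_alg : IsClosed (T.alg.toStarSubalgebra : Set (H →L[ℂ] H)) := by
  have h := T.alg.centralizer_centralizer'
  change IsClosed T.alg.carrier
  rw [← h]
  exact Set.isClosed_centralizer _

instance : CompleteSpace T.Elt := T.isClosed_alg.completeSpace_coe

instance : CStarAlgebra T.Elt where

theorem exists_star_mul_self (x : T.Elt) :
    ∃ z : T.Elt, ((‖x‖ ^ 2 : ℝ) : ℂ) • (1 : T.Elt) - star x * x = star z * z :=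
  exists_sub_eq_star_mul_self x

/-- The trace is hermitian. -/
theorem trace_star (x : T.Elt) : T.trace (star x) = star (T.trace x) := by
  have h1 := T.trace_nonneg (1 + x)
  have h2 := T.trace_nonneg (1 + Complex.I • x)
  have h3 := T.trace_nonneg x
  have h0 := T.trace_one
  simp only [star_add, star_one, star_smul, mul_add, add_mul, one_mul, mul_one, map_add,
    smul_mul_assoc, mul_smul_comm, map_smul, smul_eq_mul, Complex.star_def, Complex.conj_I,
    h0] at h1 h2
  have e1 := (Complex.nonneg_iff.1 h1).2
  have e2 := (Complex.nonneg_iff.1 h2).2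
  have e3 := (Complex.nonneg_iff.1 h3).2
  simp at e1 e2 e3
  apply Complex.ext <;> simp <;> linarith

/-- The algebra `T`, regarded as the pre-Hilbert space with `⟪x, y⟫ = τ(x* y)`. -/
def PreL2 : Type u := T.Elt

instance : AddCommGroup T.PreL2 := inferInstanceAs (AddCommGroup T.Elt)
instance : Module ℂ T.PreL2 := inferInstanceAs (Module ℂ T.Elt)

/-- The identity map from `T` to its pre-Hilbert space. -/
def toPreL2 : T.Elt ≃ₗ[ℂ] T.PreL2 := LinearEquiv.refl ℂ _

/-- The inner product `⟪x, y⟫ = τ(x* y)`. -/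
abbrev innerCore : InnerProductSpace.Core ℂ T.PreL2 where
  inner x y := T.trace (star (T.toPreL2.symm x) * T.toPreL2.symm y)
  conj_inner_symm x y := by
    rw [← Complex.star_def, ← T.trace_star]
    simp
  re_inner_nonneg x := (RCLike.nonneg_iff.1 (T.trace_nonneg _)).1
  add_left x y z := by rw [map_add, star_add, add_mul, map_add]
  smul_left x y r := by simp
  definite x h := T.toPreL2.symm.map_eq_zero_iff.1 (T.faithful _ h)

instance : NormedAddCommGroup T.PreL2 :=
  InnerProductSpace.Core.toNormedAddCommGroup (cd := T.innerCore)
instance : InnerProductSpace ℂ T.PreL2 := InnerProductSpace.ofCore T.innerCore.toCore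

/-- The Hilbert space `L²(T, τ)`: the completion of `T` for `⟪x, y⟫ = τ(x* y)`. -/
abbrev L2 : Type u := UniformSpace.Completion T.PreL2

/-- The vector `x̂` of `L²(T, τ)` given by `x ∈ T`. -/
def hat (x : T.Elt) : T.L2 := ((T.toPreL2 x : T.PreL2) : T.L2)

theorem inner_toPreL2 (x y : T.Elt) :
    ⟪T.toPreL2 x, T.toPreL2 y⟫_ℂ = T.trace (star x * y) := rfl

theorem inner_hat (x y : T.Elt) : ⟪T.hat x, T.hat y⟫_ℂ = T.trace (star x * y) := by
  unfold hat
  rw [UniformSpace.Completion.inner_coe, inner_toPreL2]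

theorem norm_sq_toPreL2 (x : T.Elt) :
    ((‖T.toPreL2 x‖ ^ 2 : ℝ) : ℂ) = T.trace (star x * x) := by
  rw [← inner_toPreL2, inner_self_eq_norm_sq_to_K]; simp

theorem norm_toPreL2_mul_le (x y : T.Elt) :
    ‖T.toPreL2 (x * y)‖ ≤ ‖x‖ * ‖T.toPreL2 y‖ := by
  obtain ⟨z, hz⟩ := T.exists_star_mul_self x
  have h := T.trace_nonneg (z * y)
  have e : star (z * y) * (z * y) = ((‖x‖ ^ 2 : ℝ) : ℂ) • (star y * y) - star (x * y) * (x * y) := by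
    calc _ = star y * (star z * z) * y := by simp [mul_assoc]
      _ = _ := by rw [← hz]; simp [mul_sub, sub_mul, mul_assoc]
  rw [e, map_sub, map_smul, ← norm_sq_toPreL2, ← norm_sq_toPreL2, smul_eq_mul,
    ← Complex.ofReal_mul, ← Complex.ofReal_sub, Complex.zero_le_real] at h
  refine le_of_sq_le_sq ?_ (by positivity)
  rw [mul_pow]; linarith

theorem norm_toPreL2_star (x : T.Elt) : ‖T.toPreL2 (star x)‖ = ‖T.toPreL2 x‖ := by
  have : ((‖T.toPreL2 (star x)‖ ^ 2 : ℝ) : ℂ) = ((‖T.toPreL2 x‖ ^ 2 : ℝ) : ℂ) := by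
    rw [norm_sq_toPreL2, norm_sq_toPreL2, star_star, T.tracial]
  exact (sq_eq_sq₀ (norm_nonneg _) (norm_nonneg _)).1 (Complex.ofReal_injective this)

/-- Left multiplication by `x` on `L²(T, τ)`: the bounded operator with `ŷ ↦ (x y)^`. -/
def leftMul (x : T.Elt) : T.L2 →L[ℂ] T.L2 :=
  ContinuousLinearMap.completion
    ((T.toPreL2.toLinearMap ∘ₗ LinearMap.mulLeft ℂ x ∘ₗ T.toPreL2.symm.toLinearMap).mkContinuous
      ‖x‖ fun y => T.norm_toPreL2_mul_le x (T.toPreL2.symm y))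

/-- Right multiplication by `x` on `L²(T, τ)`: the bounded operator with `ŷ ↦ (y x)^`. -/
def rightMul (x : T.Elt) : T.L2 →L[ℂ] T.L2 :=
  ContinuousLinearMap.completion
    ((T.toPreL2.toLinearMap ∘ₗ LinearMap.mulRight ℂ x ∘ₗ T.toPreL2.symm.toLinearMap).mkContinuous
      ‖x‖ fun y => by
        have h := T.norm_toPreL2_mul_le (star x) (star (T.toPreL2.symm y))
        rw [← star_mul, norm_toPreL2_star, norm_toPreL2_star, norm_star] at h
        exact h)

@[simp] theorem leftMul_hat (x y : T.Elt) : T.leftMul x (T.hat y) = T.hat (x * y) := by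
  simp [leftMul, hat]

@[simp] theorem rightMul_hat (x y : T.Elt) : T.rightMul x (T.hat y) = T.hat (y * x) := by
  simp [rightMul, hat]

theorem denseRange_hat : DenseRange T.hat :=
  (UniformSpace.Completion.denseRange_coe (α := T.PreL2)).comp
    T.toPreL2.surjective.denseRange (UniformSpace.Completion.continuous_coe _)

/-- Bounded operators on `L²(T, τ)` are determined by their values on `T`. -/
theorem clm_ext {E : Type v} [NormedAddCommGroup E] [NormedSpace ℂ E] {f g : T.L2 →L[ℂ] E}
    (h : ∀ x, f (T.hat x) = g (T.hat x)) : f = g :=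
  ContinuousLinearMap.coeFn_injective
    (T.denseRange_hat.equalizer f.continuous g.continuous (funext h))

theorem norm_leftMul_le (x : T.Elt) : ‖T.leftMul x‖ ≤ ‖x‖ := by
  refine ContinuousLinearMap.opNorm_le_bound _ (norm_nonneg _) fun ξ => ?_
  refine T.denseRange_hat.induction_on (p := fun ξ => ‖T.leftMul x ξ‖ ≤ ‖x‖ * ‖ξ‖) ξ ?_ ?_
  · exact isClosed_le (by fun_prop) (by fun_prop)
  · intro y
    rw [leftMul_hat]
    simpa [hat] using T.norm_toPreL2_mul_le x y

@[simp] theorem leftMul_one : T.leftMul 1 = 1 := T.clm_ext fun x => by simp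

theorem leftMul_rightMul_comm (x y : T.Elt) (ξ : T.L2) :
    T.leftMul x (T.rightMul y ξ) = T.rightMul y (T.leftMul x ξ) := by
  have : (T.leftMul x).comp (T.rightMul y) = (T.rightMul y).comp (T.leftMul x) :=
    T.clm_ext fun z => by simp [mul_assoc]
  exact congrArg (fun f : T.L2 →L[ℂ] T.L2 => f ξ) this

theorem adjoint_aux (f g : T.L2 →L[ℂ] T.L2)
    (h : ∀ x y, ⟪f (T.hat x), T.hat y⟫_ℂ = ⟪T.hat x, g (T.hat y)⟫_ℂ) : star f = g := by
  rw [ContinuousLinearMap.star_eq_adjoint, eq_comm, ContinuousLinearMap.eq_adjoint_iff]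
  intro ξ η
  refine T.denseRange_hat.induction_on₂ (p := fun ξ η => ⟪g ξ, η⟫_ℂ = ⟪ξ, f η⟫_ℂ) ?_ ?_ ξ η
  · exact isClosed_eq (by fun_prop) (by fun_prop)
  · intro x y
    rw [← inner_conj_symm, ← h, inner_conj_symm]

theorem star_leftMul (x : T.Elt) : star (T.leftMul x) = T.leftMul (star x) :=
  T.adjoint_aux _ _ fun y z => by simp [inner_hat, mul_assoc]

theorem star_rightMul (x : T.Elt) : star (T.rightMul x) = T.rightMul (star x) :=
  T.adjoint_aux _ _ fun y z => by
    simp only [rightMul_hat, inner_hat, star_mul]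
    rw [mul_assoc, T.tracial, mul_assoc]

end TracialVNA

/-! ## Operators on `ℓ²(Γ, E)` -/

/-- The Hilbert space `ℓ²(Γ, E)`. -/
abbrev EllTwo (Γ : Type v) (E : Type u) [NormedAddCommGroup E] : Type (max u v) :=
  lp (fun _ : Γ => E) 2

namespace EllTwo

variable {Γ : Type v} {E : Type u} [NormedAddCommGroup E]

theorem summable_norm_sq (ξ : EllTwo Γ E) : Summable fun s => ‖ξ s‖ ^ 2 := by
  have := (lp.memℓp ξ).summable (by norm_num)
  simpa using this

theorem norm_sq_eq (ξ : EllTwo Γ E) : ‖ξ‖ ^ 2 = ∑' s, ‖ξ s‖ ^ 2 := by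
  have := lp.norm_rpow_eq_tsum (p := 2) (by norm_num) ξ
  simpa using this

theorem memℓp_two {f : Γ → E} (h : Summable fun s => ‖f s‖ ^ 2) :
    Memℓp f 2 := by
  rw [memℓp_gen_iff (by norm_num)]
  simpa using h

open Classical in
/-- The vector `δ_s ⊗ v` of `ℓ²(Γ, E)`. -/
def delta (s : Γ) (v : E) : EllTwo Γ E := lp.single 2 s v

theorem delta_self (s : Γ) (v : E) : (delta s v : EllTwo Γ E) s = v := by
  simp [delta]

theorem delta_ne {s t : Γ} (h : t ≠ s) (v : E) : (delta s v : EllTwo Γ E) t = 0 := by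
  simp [delta, h]

variable [InnerProductSpace ℂ E]

theorem summable_op (e : Γ ≃ Γ) (S : Γ → E →L[ℂ] E) (C : ℝ) (hS : ∀ s, ‖S s‖ ≤ C)
    (ξ : EllTwo Γ E) : Summable fun s => ‖S s (ξ (e s))‖ ^ 2 := by
  refine Summable.of_nonneg_of_le (fun s => by positivity) (fun s => ?_)
    ((e.summable_iff.2 (summable_norm_sq ξ)).mul_left (C ^ 2))
  have := (S s).le_of_opNorm_le (hS s) (ξ (e s))
  rw [Function.comp_apply, ← mul_pow]
  gcongr

/-- The bounded operator `ξ ↦ (s ↦ S s (ξ (e s)))` on `ℓ²(Γ, E)`, for a permutation `e` of `Γ` and a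
family of operators `S s` on `E` whose norms are bounded by `C`. -/
def op (e : Γ ≃ Γ) (S : Γ → E →L[ℂ] E) (C : ℝ) (hS : ∀ s, ‖S s‖ ≤ C) :
    EllTwo Γ E →L[ℂ] EllTwo Γ E :=
  LinearMap.mkContinuous
    { toFun := fun ξ => ⟨fun s => S s (ξ (e s)), memℓp_two (summable_op e S C hS ξ)⟩
      map_add' := fun ξ η => by ext s; exact map_add (S s) _ _
      map_smul' := fun c ξ => by ext s; simp }
    |C| fun ξ => by
      refine le_of_sq_le_sq ?_ (by positivity)
      rw [mul_pow, norm_sq_eq, norm_sq_eq, ← e.tsum_eq (fun s => ‖ξ s‖ ^ 2), ← tsum_mul_left]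
      refine Summable.tsum_le_tsum (fun s => ?_) (summable_op e S C hS ξ)
        ((e.summable_iff.2 (summable_norm_sq ξ)).mul_left _)
      have := (S s).le_of_opNorm_le ((hS s).trans (le_abs_self C)) (ξ (e s))
      rw [← mul_pow]
      exact pow_le_pow_left₀ (norm_nonneg _) this 2

@[simp] theorem op_apply (e : Γ ≃ Γ) (S : Γ → E →L[ℂ] E) (C : ℝ) (hS : ∀ s, ‖S s‖ ≤ C)
    (ξ : EllTwo Γ E) (s : Γ) : op e S C hS ξ s = S s (ξ (e s)) := rfl

theorem star_op [CompleteSpace E] (e : Γ ≃ Γ) (S : Γ → E →L[ℂ] E) (C : ℝ) (hS : ∀ s, ‖S s‖ ≤ C)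
    (S' : Γ → E →L[ℂ] E) (C' : ℝ) (hS' : ∀ s, ‖S' s‖ ≤ C')
    (h : ∀ s, S' (e s) = star (S s)) :
    star (op e S C hS) = op e.symm S' C' hS' := by
  rw [ContinuousLinearMap.star_eq_adjoint, eq_comm, ContinuousLinearMap.eq_adjoint_iff]
  intro ξ η
  rw [lp.inner_eq_tsum, lp.inner_eq_tsum, ← e.tsum_eq]
  refine tsum_congr fun s => ?_
  simp [h, ContinuousLinearMap.star_eq_adjoint, ContinuousLinearMap.adjoint_inner_left]

theorem mem_of_delta_mem (V : Submodule ℂ (EllTwo Γ E)) (hV : IsClosed (V : Set (EllTwo Γ E)))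
    (h : ∀ s v, delta s v ∈ V) (ξ : EllTwo Γ E) : ξ ∈ V := by
  classical
  have hs := lp.hasSum_single (p := 2) (by norm_num) ξ
  refine hV.mem_of_tendsto hs (Filter.Eventually.of_forall fun F => V.sum_mem fun s _ => ?_)
  have := h s (ξ s)
  unfold delta at this
  convert this

end EllTwo

/-! ## Trace preserving actions and crossed products -/

/-- A trace preserving action of `Γ` on `(P, τ)` by `*`-automorphisms. -/
structure TracePreservingAction (Γ : Type v) [Group Γ] {H : Type u} [NormedAddCommGroup H]
    [InnerProductSpace ℂ H] [CompleteSpace H] (P : TracialVNA H) where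
  aut : Γ →* (P.Elt ≃⋆ₐ[ℂ] P.Elt)
  trace_aut : ∀ g x, P.trace (aut g x) = P.trace x

namespace TracePreservingAction

open EllTwo

variable {Γ : Type v} [Group Γ] {H : Type u} [NormedAddCommGroup H]
  [InnerProductSpace ℂ H] [CompleteSpace H] {P : TracialVNA H} (σ : TracePreservingAction Γ P)

theorem norm_aut (g : Γ) (x : P.Elt) : ‖σ.aut g x‖ = ‖x‖ :=
  StarAlgEquiv.norm_map _ x

@[simp] theorem inv_aut_aut (g : Γ) (x : P.Elt) : (σ.aut g)⁻¹ (σ.aut g x) = x :=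
  (σ.aut g).symm_apply_apply x

@[simp] theorem aut_inv_aut (g : Γ) (x : P.Elt) : σ.aut g ((σ.aut g)⁻¹ x) = x :=
  (σ.aut g).apply_symm_apply x

theorem aut_aut (g h : Γ) (x : P.Elt) : σ.aut g (σ.aut h x) = σ.aut (g * h) x := by
  rw [map_mul]; rfl

/-- The representation of `P` on `ℓ²(Γ, L²(P))`, `(π(x) ξ)(s) = σ_{s⁻¹}(x) ξ(s)`. -/
def rep (x : P.Elt) : EllTwo Γ P.L2 →L[ℂ] EllTwo Γ P.L2 :=
  op (Equiv.refl Γ) (fun s => P.leftMul (σ.aut s⁻¹ x)) ‖x‖ fun s =>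
    (P.norm_leftMul_le _).trans_eq (σ.norm_aut _ _)

/-- The canonical unitaries on `ℓ²(Γ, L²(P))`, `(u_g ξ)(s) = ξ(g⁻¹ s)`. -/
def u (g : Γ) : EllTwo Γ P.L2 →L[ℂ] EllTwo Γ P.L2 :=
  op (Equiv.mulLeft g⁻¹) (fun _ => 1) 1 fun _ => ContinuousLinearMap.norm_id_le

/-- The vector `Ω = δ_e ⊗ 1̂` of `ℓ²(Γ, L²(P))`. -/
def vacuum (Γ : Type v) [Group Γ] (P : TracialVNA H) : EllTwo Γ P.L2 := delta 1 (P.hat 1)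

/-- For a subgroup `Λ` of `Γ`, the von Neumann subalgebra `P ⋊ Λ` of `P ⋊ Γ`, generated by `P`
and the canonical unitaries `u_g`, `g ∈ Λ`. -/
def subCrossed (Λ : Subgroup Γ) : VonNeumannAlgebra (EllTwo Γ P.L2) :=
  VonNeumannAlgebra.generatedBy (Set.range σ.rep ∪ (u (P := P)) '' Λ)

theorem subCrossed_mono {Λ Λ' : Subgroup Γ} (h : Λ ≤ Λ') : σ.subCrossed Λ ≤ σ.subCrossed Λ' :=
  VonNeumannAlgebra.generatedBy_mono (Set.union_subset_union_right _ (Set.image_mono h))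

theorem rep_mem (Λ : Subgroup Γ) (x : P.Elt) : σ.rep x ∈ σ.subCrossed Λ :=
  VonNeumannAlgebra.subset_generatedBy _ (Or.inl ⟨x, rfl⟩)

theorem u_mem {Λ : Subgroup Γ} {g : Γ} (hg : g ∈ Λ) : u g ∈ σ.subCrossed Λ :=
  VonNeumannAlgebra.subset_generatedBy _ (Or.inr ⟨g, hg, rfl⟩)

theorem star_rep (x : P.Elt) : star (σ.rep x) = σ.rep (star x) :=
  star_op _ _ _ _ _ _ _ fun _ => by simp [P.star_leftMul, map_star]

theorem star_u (g : Γ) : star (u (P := P) g) = u g⁻¹ := by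
  unfold u
  rw [star_op (S' := fun _ => 1) (C' := 1)
    (hS' := fun _ => ContinuousLinearMap.norm_id_le) (h := fun _ => by simp)]
  ext ξ s
  simp

/-! The commutant of `P ⋊ Γ` on `ℓ²(Γ, L²(P))` contains the operators `rightRep` and `rightU`
below; this is what makes the vector state of `Ω` a faithful trace. -/

/-- The operators `(ρ(y) ξ)(s) = ξ(s) y`. -/
def rightRep (Γ : Type v) [Group Γ] (y : P.Elt) : EllTwo Γ P.L2 →L[ℂ] EllTwo Γ P.L2 :=
  op (Equiv.refl Γ) (fun _ => P.rightMul y) ‖P.rightMul y‖ fun _ => le_rfl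

theorem norm_toPreL2_aut (g : Γ) (x : P.Elt) :
    ‖P.toPreL2 (σ.aut g x)‖ = ‖P.toPreL2 x‖ := by
  have : ((‖P.toPreL2 (σ.aut g x)‖ ^ 2 : ℝ) : ℂ) = ((‖P.toPreL2 x‖ ^ 2 : ℝ) : ℂ) := by
    rw [P.norm_sq_toPreL2, P.norm_sq_toPreL2, ← map_star, ← map_mul, σ.trace_aut]
  exact (sq_eq_sq₀ (norm_nonneg _) (norm_nonneg _)).1 (Complex.ofReal_injective this)

/-- The extension of `σ_g` to `L²(P)`. -/
def autL2 (g : Γ) : P.L2 →L[ℂ] P.L2 :=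
  ContinuousLinearMap.completion
    ((P.toPreL2.toLinearMap ∘ₗ (σ.aut g).toAlgEquiv.toLinearMap ∘ₗ
      P.toPreL2.symm.toLinearMap).mkContinuous 1 fun y => by
        rw [one_mul]
        exact (σ.norm_toPreL2_aut g (P.toPreL2.symm y)).le)

@[simp] theorem autL2_hat (g : Γ) (x : P.Elt) : σ.autL2 g (P.hat x) = P.hat (σ.aut g x) := by
  simp [autL2, TracialVNA.hat]

theorem norm_autL2_le (g : Γ) : ‖σ.autL2 g‖ ≤ 1 := by
  refine ContinuousLinearMap.opNorm_le_bound _ zero_le_one fun ξ => ?_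
  refine P.denseRange_hat.induction_on (p := fun ξ => ‖σ.autL2 g ξ‖ ≤ 1 * ‖ξ‖) ξ ?_ ?_
  · exact isClosed_le (by fun_prop) (by fun_prop)
  · intro y
    rw [autL2_hat]
    simpa [TracialVNA.hat] using (σ.norm_toPreL2_aut g y).le

theorem star_autL2 (g : Γ) : star (σ.autL2 g) = σ.autL2 g⁻¹ :=
  P.adjoint_aux _ _ fun x y => by
    rw [autL2_hat, autL2_hat, P.inner_hat, P.inner_hat, ← σ.trace_aut g (star x * _),
      map_mul (σ.aut g), map_star (σ.aut g), σ.aut_aut]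
    simp

/-- The operators `(v_g ξ)(s) = σ_g(ξ(s g))`. -/
def rightU (g : Γ) : EllTwo Γ P.L2 →L[ℂ] EllTwo Γ P.L2 :=
  op (Equiv.mulRight g) (fun _ => σ.autL2 g) 1 fun _ => σ.norm_autL2_le g

theorem star_rightRep (y : P.Elt) : star (rightRep Γ y) = rightRep Γ (star y) :=
  star_op _ _ _ _ _ _ _ fun _ => by simp [P.star_rightMul]

theorem star_rightU (g : Γ) : star (σ.rightU g) = σ.rightU g⁻¹ := by
  unfold rightU
  rw [star_op (S' := fun _ => σ.autL2 g⁻¹) (C' := 1)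
    (hS' := fun _ => σ.norm_autL2_le _) (h := fun _ => (σ.star_autL2 g).symm)]
  ext ξ s
  simp

theorem autL2_leftMul (g : Γ) (x : P.Elt) (ξ : P.L2) :
    σ.autL2 g (P.leftMul x ξ) = P.leftMul (σ.aut g x) (σ.autL2 g ξ) := by
  have : (σ.autL2 g).comp (P.leftMul x) = (P.leftMul (σ.aut g x)).comp (σ.autL2 g) :=
    P.clm_ext fun z => by simp
  exact congrArg (fun f : P.L2 →L[ℂ] P.L2 => f ξ) this

/-- Operators commuting with the generators commute with `P ⋊ Γ`. -/
theorem comm_of_comm {y : EllTwo Γ P.L2 →L[ℂ] EllTwo Γ P.L2}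
    (h1 : ∀ x, σ.rep x * y = y * σ.rep x) (h2 : ∀ g, u g * y = y * u g)
    {Λ : Subgroup Γ} {x : EllTwo Γ P.L2 →L[ℂ] EllTwo Γ P.L2} (hx : x ∈ σ.subCrossed Λ) :
    y * x = x * y := by
  refine VonNeumannAlgebra.mem_generatedBy_iff.1 hx y ?_
  rintro _ (⟨z, rfl⟩ | ⟨g, -, rfl⟩)
  · exact ⟨h1 z, by rw [star_rep, h1]⟩
  · exact ⟨h2 g, by rw [star_u, h2]⟩

theorem rightRep_comm (y : P.Elt) {Λ : Subgroup Γ} {x : EllTwo Γ P.L2 →L[ℂ] EllTwo Γ P.L2}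
    (hx : x ∈ σ.subCrossed Λ) : rightRep Γ y * x = x * rightRep Γ y := by
  refine σ.comm_of_comm (fun z => ?_) (fun g => ?_) hx
  · ext ξ s
    simp [rep, rightRep, P.leftMul_rightMul_comm]
  · ext ξ s
    simp [u, rightRep]

theorem rightU_comm (h : Γ) {Λ : Subgroup Γ} {x : EllTwo Γ P.L2 →L[ℂ] EllTwo Γ P.L2}
    (hx : x ∈ σ.subCrossed Λ) : σ.rightU h * x = x * σ.rightU h := by
  refine σ.comm_of_comm (fun z => ?_) (fun g => ?_) hx
  · ext ξ s
    simp [rep, rightU, autL2_leftMul]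
  · ext ξ s
    simp [u, rightU, mul_assoc]

theorem rep_delta (x y : P.Elt) (s : Γ) :
    σ.rep x (delta s (P.hat y)) = delta s (P.hat (σ.aut s⁻¹ x * y)) := by
  ext t
  by_cases h : t = s
  · subst h; simp [rep, delta_self]
  · simp [rep, delta_ne h]

theorem u_delta (g s : Γ) (v : P.L2) : u g (delta s v) = delta (g * s) v := by
  ext t
  by_cases h : t = g * s
  · subst h; simp [u, delta_self]
  · have h' : g⁻¹ * t ≠ s := fun e => h (by rw [← e]; simp)
    simp [u, delta_ne h, delta_ne h']

theorem rightRep_delta (x y : P.Elt) (s : Γ) :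
    rightRep Γ x (delta s (P.hat y)) = delta s (P.hat (y * x)) := by
  ext t
  by_cases h : t = s
  · subst h; simp [rightRep, delta_self]
  · simp [rightRep, delta_ne h]

theorem rightU_delta (g s : Γ) (y : P.Elt) :
    σ.rightU g (delta s (P.hat y)) = delta (s * g⁻¹) (P.hat (σ.aut g y)) := by
  ext t
  by_cases h : t = s * g⁻¹
  · subst h; simp [rightU, delta_self]
  · have h' : t * g ≠ s := fun e => h (by rw [← e]; simp)
    simp [rightU, delta_ne h, delta_ne h']

theorem mem_of_hat_mem (V : Submodule ℂ (EllTwo Γ P.L2))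
    (hV : IsClosed (V : Set (EllTwo Γ P.L2))) (h : ∀ s x, delta s (P.hat x) ∈ V)
    (ξ : EllTwo Γ P.L2) : ξ ∈ V := by
  classical
  refine mem_of_delta_mem V hV (fun s v => ?_) ξ
  have hc : Continuous fun v : P.L2 => (delta s v : EllTwo Γ P.L2) :=
    (lp.isometry_single (E := fun _ : Γ => P.L2) (p := 2) s).continuous.congr fun v => by
      unfold delta; congr
  exact P.denseRange_hat.induction_on (p := fun v => delta s v ∈ V) v (hV.preimage hc)
    fun x => h s x

/-- `Ω` is separating for `P ⋊ Γ`. -/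
theorem eq_zero_of_apply_vacuum {Λ : Subgroup Γ} {x : EllTwo Γ P.L2 →L[ℂ] EllTwo Γ P.L2}
    (hx : x ∈ σ.subCrossed Λ) (h : x (vacuum Γ P) = 0) : x = 0 := by
  ext1 ξ
  refine mem_of_hat_mem (LinearMap.ker x.toLinearMap) x.isClosed_ker (fun s y => ?_) ξ
  have e : delta s (P.hat y) = rightRep Γ y (σ.rightU s⁻¹ (vacuum Γ P)) := by
    simp [vacuum, rightU_delta, rightRep_delta]
  have c : ∀ η, x (rightRep Γ y (σ.rightU s⁻¹ η)) = rightRep Γ y (σ.rightU s⁻¹ (x η)) := by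
    intro η
    have h1 := congrArg (fun f => f (σ.rightU s⁻¹ η)) (σ.rightRep_comm y hx)
    have h2 := congrArg (fun f => f η) (σ.rightU_comm s⁻¹ hx)
    simp only [mul_apply_eq_comp] at h1 h2
    rw [← h1, ← h2]
  rw [LinearMap.mem_ker, ContinuousLinearMap.coe_coe, e, c, h, map_zero, map_zero]

/-- For `x` in `P ⋊ Γ` and a generator `y = π(p) u_g`, the vector state of `Ω` satisfies
`τ(x y) = τ(y x)`. -/
theorem inner_generator {Λ : Subgroup Γ} {x : EllTwo Γ P.L2 →L[ℂ] EllTwo Γ P.L2}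
    (hx : x ∈ σ.subCrossed Λ) (p : P.Elt) (g : Γ) :
    ⟪vacuum Γ P, x ((σ.rep p * u (P := P) g) (vacuum Γ P))⟫_ℂ =
      ⟪star (σ.rep p * u (P := P) g) (vacuum Γ P), x (vacuum Γ P)⟫_ℂ := by
  have e1 : (σ.rep p * u (P := P) g) (vacuum Γ P) = σ.rightU g⁻¹ (rightRep Γ p (vacuum Γ P)) := by
    simp [vacuum, rightU_delta, rightRep_delta, u_delta, rep_delta]
  have e2 : star (σ.rep p * u (P := P) g) (vacuum Γ P) =
      star (σ.rightU g⁻¹ * rightRep Γ p) (vacuum Γ P) := by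
    simp [vacuum, star_mul, star_rep, star_u, star_rightU, star_rightRep, rightU_delta,
      rightRep_delta, u_delta, rep_delta]
  have c : x ((σ.rightU g⁻¹ * rightRep Γ p) (vacuum Γ P)) =
      (σ.rightU g⁻¹ * rightRep Γ p) (x (vacuum Γ P)) := by
    have h1 := congrArg (fun f => f (vacuum Γ P)) (σ.rightRep_comm p hx)
    have h2 := congrArg (fun f => f (rightRep Γ p (vacuum Γ P))) (σ.rightU_comm g⁻¹ hx)
    simp only [mul_apply_eq_comp] at h1 h2 ⊢
    rw [← h2, h1]
  rw [e1, e2]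
  change ⟪_, x ((σ.rightU g⁻¹ * rightRep Γ p) (vacuum Γ P))⟫_ℂ = _
  rw [c, ContinuousLinearMap.star_eq_adjoint, ContinuousLinearMap.adjoint_inner_left]

/-- The vectors `y Ω`, with `y` in the linear span of the `π(p) u_g`, are dense. -/
theorem vacuum_cyclic (ξ : EllTwo Γ P.L2) :
    ξ ∈ closure ((fun y => y (vacuum Γ P)) ''
      (Submodule.span ℂ (Set.range fun q : P.Elt × Γ => σ.rep q.1 * u q.2) :
        Set (EllTwo Γ P.L2 →L[ℂ] EllTwo Γ P.L2))) := by
  let ev : (EllTwo Γ P.L2 →L[ℂ] EllTwo Γ P.L2) →ₗ[ℂ] EllTwo Γ P.L2 :=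
    { toFun := fun y => y (vacuum Γ P), map_add' := fun _ _ => rfl, map_smul' := fun _ _ => rfl }
  let V := ((Submodule.span ℂ (Set.range fun q : P.Elt × Γ => σ.rep q.1 * u q.2)).map
    ev).topologicalClosure
  refine mem_of_hat_mem V (Submodule.isClosed_topologicalClosure _) (fun s x => ?_) ξ
  refine Submodule.le_topologicalClosure _ ⟨_, Submodule.subset_span ⟨(σ.aut s x, s), rfl⟩, ?_⟩
  simp [ev, vacuum, u_delta, rep_delta]

theorem generator_mem (p : P.Elt) (g : Γ) : σ.rep p * u g ∈ σ.subCrossed ⊤ :=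
  mul_mem (σ.rep_mem _ p) (σ.u_mem (Subgroup.mem_top g))

theorem span_spec {z : EllTwo Γ P.L2 →L[ℂ] EllTwo Γ P.L2}
    (hz : z ∈ Submodule.span ℂ (Set.range fun q : P.Elt × Γ => σ.rep q.1 * u q.2)) :
    z ∈ σ.subCrossed ⊤ ∧ ∀ x ∈ σ.subCrossed (⊤ : Subgroup Γ),
      ⟪vacuum Γ P, x (z (vacuum Γ P))⟫_ℂ = ⟪star z (vacuum Γ P), x (vacuum Γ P)⟫_ℂ := by
  induction hz using Submodule.span_induction with
  | mem z hz =>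
    obtain ⟨q, rfl⟩ := hz
    exact ⟨σ.generator_mem _ _, fun x hx => σ.inner_generator hx _ _⟩
  | zero => exact ⟨zero_mem _, fun x _ => by simp⟩
  | add y z _ _ hy hz =>
    refine ⟨add_mem hy.1 hz.1, fun x hx => ?_⟩
    simp [hy.2 x hx, hz.2 x hx]
  | smul c z _ hz =>
    refine ⟨(σ.subCrossed ⊤).toStarSubalgebra.smul_mem hz.1 c, fun x hx => ?_⟩
    simp [hz.2 x hx, mul_comm]

theorem norm_star_apply_vacuum_le {d : EllTwo Γ P.L2 →L[ℂ] EllTwo Γ P.L2}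
    (hd : d ∈ σ.subCrossed ⊤) : ‖star d (vacuum Γ P)‖ ≤ ‖d (vacuum Γ P)‖ := by
  have key : ∀ v, ‖⟪star d (vacuum Γ P), v⟫_ℂ‖ ≤ ‖v‖ * ‖d (vacuum Γ P)‖ := by
    intro v
    refine closure_minimal (s := _) (t := {v | ‖⟪star d (vacuum Γ P), v⟫_ℂ‖ ≤
      ‖v‖ * ‖d (vacuum Γ P)‖}) ?_ (isClosed_le (by fun_prop) (by fun_prop)) (σ.vacuum_cyclic v)
    rintro _ ⟨w, hw, rfl⟩
    obtain ⟨hwM, hw⟩ := σ.span_spec hw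
    have h1 : ⟪star d (vacuum Γ P), w (vacuum Γ P)⟫_ℂ =
        ⟪star w (vacuum Γ P), d (vacuum Γ P)⟫_ℂ := by
      rw [← hw d hd, ContinuousLinearMap.star_eq_adjoint, ContinuousLinearMap.adjoint_inner_left]
    have h2 : ‖star w (vacuum Γ P)‖ = ‖w (vacuum Γ P)‖ := by
      have := hw (star w) (star_mem hwM)
      rw [inner_self_eq_norm_sq_to_K, ContinuousLinearMap.star_eq_adjoint,
        ContinuousLinearMap.adjoint_inner_right, inner_self_eq_norm_sq_to_K] at this
      have h3 : ‖w (vacuum Γ P)‖ ^ 2 = ‖star w (vacuum Γ P)‖ ^ 2 := by exact_mod_cast this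
      exact ((sq_eq_sq₀ (norm_nonneg _) (norm_nonneg _)).1 h3).symm
    change ‖⟪star d (vacuum Γ P), w (vacuum Γ P)⟫_ℂ‖ ≤ ‖w (vacuum Γ P)‖ * _
    rw [h1, ← h2]
    exact norm_inner_le_norm _ _
  have h := key (star d (vacuum Γ P))
  rw [inner_self_eq_norm_sq_to_K] at h
  have h' : ‖((‖star d (vacuum Γ P)‖ : ℝ) : ℂ) ^ 2‖ = ‖star d (vacuum Γ P)‖ ^ 2 := by simp
  have h2 := h'.symm.trans_le h
  by_contra hlt
  push Not at hlt
  have := (norm_nonneg (d (vacuum Γ P))).trans_lt hlt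
  nlinarith

theorem norm_star_apply_vacuum {d : EllTwo Γ P.L2 →L[ℂ] EllTwo Γ P.L2}
    (hd : d ∈ σ.subCrossed ⊤) : ‖star d (vacuum Γ P)‖ = ‖d (vacuum Γ P)‖ :=
  (σ.norm_star_apply_vacuum_le hd).antisymm
    (by simpa using σ.norm_star_apply_vacuum_le (star_mem hd))

/-- The vector state of `Ω` is a trace on `P ⋊ Γ`. -/
theorem inner_vacuum_comm {x y : EllTwo Γ P.L2 →L[ℂ] EllTwo Γ P.L2}
    (hx : x ∈ σ.subCrossed ⊤) (hy : y ∈ σ.subCrossed ⊤) :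
    ⟪vacuum Γ P, x (y (vacuum Γ P))⟫_ℂ = ⟪vacuum Γ P, y (x (vacuum Γ P))⟫_ℂ := by
  have sm : ∀ (c : ℂ) {z : EllTwo Γ P.L2 →L[ℂ] EllTwo Γ P.L2},
      z ∈ σ.subCrossed ⊤ → c • z ∈ σ.subCrossed (⊤ : Subgroup Γ) := fun c z hz =>
    (σ.subCrossed ⊤).toStarSubalgebra.smul_mem hz c
  have hI : ∀ v : EllTwo Γ P.L2, ‖Complex.I • v‖ = ‖v‖ := fun v => by simp [norm_smul]
  have h1 := σ.norm_star_apply_vacuum (add_mem hx (star_mem hy))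
  have h2 := σ.norm_star_apply_vacuum (sub_mem hx (star_mem hy))
  have h3 := σ.norm_star_apply_vacuum (add_mem hx (sm Complex.I (star_mem hy)))
  have h4 := σ.norm_star_apply_vacuum (sub_mem hx (sm Complex.I (star_mem hy)))
  have e1 : ⟪vacuum Γ P, x (y (vacuum Γ P))⟫_ℂ = ⟪star x (vacuum Γ P), y (vacuum Γ P)⟫_ℂ := by
    rw [ContinuousLinearMap.star_eq_adjoint, ContinuousLinearMap.adjoint_inner_left]
  have e2 : ⟪vacuum Γ P, y (x (vacuum Γ P))⟫_ℂ = ⟪star y (vacuum Γ P), x (vacuum Γ P)⟫_ℂ := by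
    rw [ContinuousLinearMap.star_eq_adjoint, ContinuousLinearMap.adjoint_inner_left]
  rw [e1, e2, inner_eq_sum_norm_sq_div_four, inner_eq_sum_norm_sq_div_four]
  set Ω := vacuum Γ P
  have g1 : ‖star x Ω + y Ω‖ = ‖star y Ω + x Ω‖ := by
    rw [add_comm (star y Ω)]
    simpa using h1
  have g2 : ‖star x Ω - y Ω‖ = ‖star y Ω - x Ω‖ := by
    rw [norm_sub_rev (star y Ω)]
    simpa using h2
  have g3 : ‖star x Ω - Complex.I • y Ω‖ = ‖star y Ω - Complex.I • x Ω‖ := by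
    rw [← hI (star y Ω - _), smul_sub, smul_smul, Complex.I_mul_I, neg_one_smul, sub_neg_eq_add,
      add_comm (Complex.I • _)]
    simpa [sub_eq_add_neg] using h3
  have g4 : ‖star x Ω + Complex.I • y Ω‖ = ‖star y Ω + Complex.I • x Ω‖ := by
    rw [← hI (star y Ω + _), smul_add, smul_smul, Complex.I_mul_I, neg_one_smul,
      ← sub_eq_add_neg, norm_sub_rev (Complex.I • _)]
    simpa [sub_eq_add_neg] using h4
  simp only [RCLike.I_to_complex, g1, g2, g3, g4]

theorem inner_vacuum_self : ⟪vacuum Γ P, vacuum Γ P⟫_ℂ = 1 := by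
  have h := lp.hasSum_inner (𝕜 := ℂ) (vacuum Γ P) (vacuum Γ P)
  rw [← h.tsum_eq, tsum_eq_single 1 fun s hs => by simp [vacuum, delta_ne hs]]
  rw [vacuum, delta_self, P.inner_hat, star_one, one_mul, P.trace_one]

/-- The crossed product `M = P ⋊ Γ` with its canonical trace `τ(x) = ⟪Ω, x Ω⟫`. -/
def crossedProduct : TracialVNA (EllTwo Γ P.L2) where
  alg := σ.subCrossed ⊤
  trace :=
    { toFun := fun x => ⟪vacuum Γ P, (x : EllTwo Γ P.L2 →L[ℂ] EllTwo Γ P.L2) (vacuum Γ P)⟫_ℂ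
      map_add' := fun x y => by simp
      map_smul' := fun c x => by simp }
  trace_one := inner_vacuum_self
  trace_nonneg := fun x => by
    change 0 ≤ ⟪vacuum Γ P, star x.1 (x.1 (vacuum Γ P))⟫_ℂ
    rw [ContinuousLinearMap.star_eq_adjoint, ContinuousLinearMap.adjoint_inner_right,
      inner_self_eq_norm_sq_to_K]
    have h : (0 : ℝ) ≤ ‖x.1 (vacuum Γ P)‖ ^ 2 := sq_nonneg _
    have h' := Complex.zero_le_real.2 h
    rwa [Complex.ofReal_pow] at h'
  faithful := fun x hx => by
    change ⟪vacuum Γ P, star x.1 (x.1 (vacuum Γ P))⟫_ℂ = 0 at hx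
    rw [ContinuousLinearMap.star_eq_adjoint, ContinuousLinearMap.adjoint_inner_right,
      inner_self_eq_zero] at hx
    exact Subtype.ext (σ.eq_zero_of_apply_vacuum x.2 hx)
  tracial := fun x y => σ.inner_vacuum_comm x.2 y.2
  normal := by
    refine ⟨Pi.single 0 (vacuum Γ P), Pi.single 0 (vacuum Γ P), ?_, ?_, fun x => ?_⟩
    · exact (hasSum_single 0 fun i hi => by simp [hi]).summable
    · exact (hasSum_single 0 fun i hi => by simp [hi]).summable
    · have := hasSum_single (f := fun i : ℕ => ⟪(Pi.single 0 (vacuum Γ P) : ℕ → EllTwo Γ P.L2) i,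
        x.1 ((Pi.single 0 (vacuum Γ P) : ℕ → EllTwo Γ P.L2) i)⟫_ℂ) 0 fun i hi => by simp [hi]
      simpa using this

/-- The canonical unitaries, as elements of `P ⋊ Γ`. -/
def uElt (g : Γ) : σ.crossedProduct.Elt := ⟨u g, σ.u_mem (Subgroup.mem_top g)⟩

end TracePreservingAction

/-! ## Bimodules in `L²(M)` -/

/-- An `N`-`N`-subbimodule of `L²(M)`: a closed subspace which is invariant under left and right
multiplication by elements of `N`. -/
structure L2Subbimodule {H : Type u} [NormedAddCommGroup H] [InnerProductSpace ℂ H]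
    [CompleteSpace H] (M : TracialVNA H) (N : VonNeumannAlgebra H) where
  carrier : Submodule ℂ M.L2
  isClosed : IsClosed (carrier : Set M.L2)
  left_mem : ∀ x : M.Elt, x.1 ∈ N → ∀ ξ ∈ carrier, M.leftMul x ξ ∈ carrier
  right_mem : ∀ x : M.Elt, x.1 ∈ N → ∀ ξ ∈ carrier, M.rightMul x ξ ∈ carrier

namespace L2Subbimodule

variable {H : Type u} [NormedAddCommGroup H] [InnerProductSpace ℂ H] [CompleteSpace H]
  {M : TracialVNA H} {N : VonNeumannAlgebra H}

/-- A bimodule is irreducible if it is nonzero and has no subbimodules besides `0` and itself. -/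
def IsIrreducible (K : L2Subbimodule M N) : Prop :=
  K.carrier ≠ ⊥ ∧
    ∀ L : L2Subbimodule M N, L.carrier ≤ K.carrier → L.carrier = ⊥ ∨ L.carrier = K.carrier

/-- Two bimodules are isomorphic if there is a unitary between them which intertwines the left
and the right actions of `N`. -/
def Iso (K L : L2Subbimodule M N) : Prop :=
  ∃ U : K.carrier ≃ₗᵢ[ℂ] L.carrier, ∀ (x : M.Elt) (hx : x.1 ∈ N) (ξ : K.carrier),
    (U ⟨M.leftMul x ξ, K.left_mem x hx ξ ξ.2⟩ : M.L2) = M.leftMul x (U ξ) ∧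
    (U ⟨M.rightMul x ξ, K.right_mem x hx ξ ξ.2⟩ : M.L2) = M.rightMul x (U ξ)

theorem closure_invariant (S : Set M.L2) (f : M.L2 →L[ℂ] M.L2) (h : ∀ ξ ∈ S, f ξ ∈ S)
    (ξ : M.L2) (hξ : ξ ∈ (Submodule.span ℂ S).topologicalClosure) :
    f ξ ∈ (Submodule.span ℂ S).topologicalClosure := by
  have h1 : Set.MapsTo f (Submodule.span ℂ S) (Submodule.span ℂ S) := fun η hη => by
    have : Submodule.span ℂ S ≤ (Submodule.span ℂ S).comap f.toLinearMap :=
      Submodule.span_le.2 fun ζ hζ => Submodule.subset_span (h ζ hζ)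
    exact this hη
  exact h1.closure f.continuous hξ

/-- The bimodule generated by `w ∈ M`: the closed linear span of `N w N` in `L²(M)`. -/
def closedSpan (N : VonNeumannAlgebra H) (w : M.Elt) : L2Subbimodule M N where
  carrier := (Submodule.span ℂ
    {ξ | ∃ x y : M.Elt, x.1 ∈ N ∧ y.1 ∈ N ∧ ξ = M.hat (x * w * y)}).topologicalClosure
  isClosed := Submodule.isClosed_topologicalClosure _
  left_mem := fun z hz ξ hξ => closure_invariant _ _ (by
    rintro _ ⟨x, y, hx, hy, rfl⟩
    exact ⟨z * x, y, mul_mem hz hx, hy, by simp [mul_assoc]⟩) ξ hξ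
  right_mem := fun z hz ξ hξ => closure_invariant _ _ (by
    rintro _ ⟨x, y, hx, hy, rfl⟩
    exact ⟨x, y * z, hx, mul_mem hy hz, by simp [mul_assoc]⟩) ξ hξ

end L2Subbimodule

/-! ## Baumslag-Solitar groups -/

/-- The relator `b aⁿ b⁻¹ a⁻ᵐ`, where `a` and `b` are the free generators indexed by `0` and `1`. -/
def baumslagSolitarRelator (n m : ℤ) : FreeGroup (Fin 2) :=
  FreeGroup.of 1 * FreeGroup.of 0 ^ n * (FreeGroup.of 1)⁻¹ * (FreeGroup.of 0 ^ m)⁻¹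

/-- The Baumslag-Solitar group `BS(n, m) = ⟨a, b | b aⁿ b⁻¹ = aᵐ⟩`. -/
abbrev BaumslagSolitar (n m : ℤ) : Type := PresentedGroup {baumslagSolitarRelator n m}

namespace BaumslagSolitar

/-- The generator `a` of `BS(n, m)`. -/
def a (n m : ℤ) : BaumslagSolitar n m := PresentedGroup.of 0

/-- The left index `l(g) = [⟨a⟩ : ⟨a⟩ ∩ g⁻¹⟨a⟩g]`. -/
def l {n m : ℤ} (g : BaumslagSolitar n m) : ℕ :=
  ((Subgroup.zpowers (a n m)).map (MulAut.conj g⁻¹).toMonoidHom).relIndex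
    (Subgroup.zpowers (a n m))

end BaumslagSolitar

end

/-! The vector `û_g` is determined up to a scalar by its commutation relations with `N`. Suppose `ξ
∈ L²(M)` satisfies `y ξ = ξ x` whenever `x, y ∈ N` and `y u_g = u_g x`. Among these relations are
`σ_g(p) u_g = u_g p` for `p ∈ P`, and `u_{gkg⁻¹} u_g = u_g u_k` for `k ∈ ⟨a^l(g)⟩`, since `g k g⁻¹ ∈
⟨a⟩`. Hence `u_g* ξ` commutes with `P` and with `u_k` for all such `k`, and irreducibility of `P ⋊
⟨a^l(g)⟩ ⊂ M` should make it a scalar multiple of `1̂` (`eq_smul_hat_uElt`).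

Both claims follow. The projection onto a subbimodule of `K_g` commutes with the two actions of `N`,
so it sends `û_g` to some `c û_g`; the subbimodule is zero or everything according to whether `c =
0` (`isIrreducible_closedSpan`). A bimodule isomorphism `K_g → K_h` also sends `û_g` to a multiple
of itself, nonzero by injectivity, so `û_g ∈ K_h` (`Iso.hat_mem`). But `K_h` is supported on
`⟨a⟩h⟨a⟩`, which must therefore contain `g` (`mem_doubleCoset_of_mem_closedSpan`). Conversely, equal
double cosets give the same subspace.

The analytic point is that irreducibility concerns elements of `M`, while `η = u_g* ξ` is only an
`L²` vector. Unbounded operators are avoided by a convexity argument (`exists_commuting_approx`):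
the elements of `M` of bounded operator norm that are `ε`-close to `η` form a convex set, closed in
`L²`, and stable under conjugation by the unitaries commuting with `η`. Its point of minimal norm
commutes with those unitaries, so it is a scalar; thus `η` is a limit of scalars. -/

/-! ### Minimal-norm points of convex sets. -/

/-- A nonempty closed convex set in a Hilbert space contains a point which is fixed by every
norm-nonincreasing map of the set into itself: its point of minimal norm. -/
theorem exists_mem_forall_contraction_fixed {E : Type*} [NormedAddCommGroup E]
    [InnerProductSpace ℂ E] [CompleteSpace E] {C : Set E} (hne : C.Nonempty) (hcl : IsClosed C)
    (hconv : ∀ x ∈ C, ∀ y ∈ C, ∀ a b : ℝ, 0 ≤ a → 0 ≤ b → a + b = 1 →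
      (a : ℂ) • x + (b : ℂ) • y ∈ C) :
    ∃ v ∈ C, ∀ f : E → E, Set.MapsTo f C C → (∀ z, ‖f z‖ ≤ ‖z‖) → f v = v := by
  let _ : InnerProductSpace ℝ E := InnerProductSpace.complexToReal
  have hC : Convex ℝ C := fun x hx y hy a b ha hb hab => by
    have := hconv x hx y hy a b ha hb hab
    rwa [Complex.coe_smul, Complex.coe_smul] at this
  obtain ⟨v, hv, hmin⟩ := exists_norm_eq_iInf_of_complete_convex hne hcl.isComplete hC 0
  refine ⟨v, hv, fun f hf hle => ?_⟩
  have h1 := (norm_eq_iInf_iff_real_inner_le_zero hC hv).1 hmin _ (hf hv)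
  have h2 := hle v
  -- Minimality gives `‖v‖² ≤ ⟪v, f v⟫` for the real inner product, hence `‖f v - v‖² ≤ ‖f v‖² -
  -- ‖v‖² ≤ 0`.
  have h3 : ‖f v - v‖ ^ 2 ≤ 0 := by
    rw [zero_sub, inner_neg_left, inner_sub_right, real_inner_self_eq_norm_sq] at h1
    rw [norm_sub_sq_real, real_inner_comm]
    have := pow_le_pow_left₀ (norm_nonneg _) h2 2
    linarith
  exact sub_eq_zero.1 (norm_eq_zero.1 (pow_eq_zero_iff two_ne_zero |>.1
    (h3.antisymm (sq_nonneg _))))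

/-! ### Left and right multiplication on `L²`, and approximation by commuting elements. -/

namespace TracialVNA

variable {H : Type u} [NormedAddCommGroup H] [InnerProductSpace ℂ H] [CompleteSpace H]
variable (T : TracialVNA H)

/-- The map `x ↦ x̂` as a linear map. -/
noncomputable def hatLinear : T.Elt →ₗ[ℂ] T.L2 where
  toFun := T.hat
  map_add' x y := by simp [hat, UniformSpace.Completion.coe_add]
  map_smul' c x := by simp [hat, UniformSpace.Completion.coe_smul]

theorem hat_add (x y : T.Elt) : T.hat (x + y) = T.hat x + T.hat y := map_add T.hatLinear x y

theorem hat_sub (x y : T.Elt) : T.hat (x - y) = T.hat x - T.hat y := map_sub T.hatLinear x y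

theorem hat_smul (c : ℂ) (x : T.Elt) : T.hat (c • x) = c • T.hat x := map_smul T.hatLinear c x

theorem hat_injective : Function.Injective T.hat :=
  (UniformSpace.Completion.coe_injective _).comp T.toPreL2.injective

theorem leftMul_mul (x y : T.Elt) (ξ : T.L2) :
    T.leftMul (x * y) ξ = T.leftMul x (T.leftMul y ξ) := by
  have : T.leftMul (x * y) = (T.leftMul x).comp (T.leftMul y) :=
    T.clm_ext fun z => by simp [mul_assoc]
  exact congrArg (fun f : T.L2 →L[ℂ] T.L2 => f ξ) this

theorem rightMul_mul (x y : T.Elt) (ξ : T.L2) :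
    T.rightMul (x * y) ξ = T.rightMul y (T.rightMul x ξ) := by
  have : T.rightMul (x * y) = (T.rightMul y).comp (T.rightMul x) :=
    T.clm_ext fun z => by simp [mul_assoc]
  exact congrArg (fun f : T.L2 →L[ℂ] T.L2 => f ξ) this

@[simp] theorem rightMul_one : T.rightMul 1 = 1 := T.clm_ext fun x => by simp

theorem norm_leftMul_apply {v : T.Elt} (hv : star v * v = 1) (ξ : T.L2) :
    ‖T.leftMul v ξ‖ = ‖ξ‖ := by
  refine (sq_eq_sq₀ (norm_nonneg _) (norm_nonneg _)).1 ?_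
  have h : ⟪T.leftMul v ξ, T.leftMul v ξ⟫_ℂ = ⟪ξ, ξ⟫_ℂ := by
    rw [← ContinuousLinearMap.adjoint_inner_right, ← ContinuousLinearMap.star_eq_adjoint,
      T.star_leftMul, ← T.leftMul_mul, hv, leftMul_one, one_apply_eq_self]
  rw [inner_self_eq_norm_sq_to_K, inner_self_eq_norm_sq_to_K] at h
  exact_mod_cast h

theorem norm_rightMul_apply {v : T.Elt} (hv : v * star v = 1) (ξ : T.L2) :
    ‖T.rightMul v ξ‖ = ‖ξ‖ := by
  refine (sq_eq_sq₀ (norm_nonneg _) (norm_nonneg _)).1 ?_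
  have h : ⟪T.rightMul v ξ, T.rightMul v ξ⟫_ℂ = ⟪ξ, ξ⟫_ℂ := by
    rw [← ContinuousLinearMap.adjoint_inner_right, ← ContinuousLinearMap.star_eq_adjoint,
      T.star_rightMul, ← T.rightMul_mul, hv, rightMul_one, one_apply_eq_self]
  rw [inner_self_eq_norm_sq_to_K, inner_self_eq_norm_sq_to_K] at h
  exact_mod_cast h

instance : Nontrivial T.Elt :=
  ⟨1, 0, fun h => by simpa [h] using T.trace_one⟩

theorem norm_combo_le {E : Type*} [SeminormedAddCommGroup E] [NormedSpace ℂ E] {x y : E} {r a b : ℝ}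
    (hx : ‖x‖ ≤ r) (hy : ‖y‖ ≤ r) (ha : 0 ≤ a) (hb : 0 ≤ b) (hab : a + b = 1) :
    ‖(a : ℂ) • x + (b : ℂ) • y‖ ≤ r := by
  refine (norm_add_le _ _).trans ?_
  rw [norm_smul, norm_smul, Complex.norm_of_nonneg ha, Complex.norm_of_nonneg hb]
  calc a * ‖x‖ + b * ‖y‖ ≤ a * r + b * r := by gcongr
    _ = r := by rw [← add_mul, hab, one_mul]

/-- If the balls of `T` are closed in `L²(T, τ)`, then every `η ∈ L²(T, τ)` is approximated by
elements of `T` commuting with all unitaries of `T` that commute with `η`. -/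
theorem exists_commuting_approx (hball : ∀ r, IsClosed (T.hat '' Metric.closedBall 0 r))
    (η : T.L2) {ε : ℝ} (hε : 0 < ε) :
    ∃ y : T.Elt, ‖T.hat y - η‖ ≤ ε ∧
      ∀ v ∈ unitary T.Elt, T.leftMul v η = T.rightMul v η → v * y = y * v := by
  obtain ⟨x, hx⟩ := T.denseRange_hat.exists_dist_lt η hε
  rw [dist_comm, dist_eq_norm] at hx
  -- The operator norm bound ensures that the minimal point comes from an element of `T`; the radius
  -- `‖x‖` makes `x̂` a member, so the set is nonempty.
  obtain ⟨_, ⟨⟨y, hy, rfl⟩, hyη⟩, hfix⟩ := exists_mem_forall_contraction_fixed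
    (C := T.hat '' Metric.closedBall 0 ‖x‖ ∩ Metric.closedBall η ε)
    ⟨T.hat x, ⟨x, by simp, rfl⟩, by simpa [dist_eq_norm] using hx.le⟩
    ((hball _).inter Metric.isClosed_closedBall)
    (by
      rintro _ ⟨⟨z, hz, rfl⟩, hzη⟩ _ ⟨⟨w, hw, rfl⟩, hwη⟩ a b ha hb hab
      rw [mem_closedBall_zero_iff] at hz hw
      rw [Metric.mem_closedBall, dist_eq_norm] at hzη hwη
      have e : (a : ℂ) • T.hat z + (b : ℂ) • T.hat w =
          T.hat ((a : ℂ) • z + (b : ℂ) • w) := by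
        simp only [hat_add, hat_smul]
      refine ⟨⟨(a : ℂ) • z + (b : ℂ) • w, ?_, e.symm⟩, ?_⟩
      · rw [mem_closedBall_zero_iff]
        exact norm_combo_le hz hw ha hb hab
      · have e' : η = (a : ℂ) • η + (b : ℂ) • η := by
          rw [← add_smul, ← Complex.ofReal_add, hab, Complex.ofReal_one, one_smul]
        rw [Metric.mem_closedBall, dist_eq_norm]
        nth_rewrite 1 [e']
        rw [add_sub_add_comm, ← smul_sub, ← smul_sub]
        exact norm_combo_le hzη hwη ha hb hab)
  refine ⟨y, by simpa [dist_eq_norm] using hyη, fun v hv hvη => ?_⟩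
  obtain ⟨hv1, hv2⟩ := Unitary.mem_iff.1 hv
  -- Conjugation by `v` is an isometry of `L²` fixing `η`, so it preserves the ball around `η`; it
  -- also preserves the operator norm, hence maps the convex set to itself.
  have hη : T.leftMul v (T.rightMul (star v) η) = η := by
    rw [T.leftMul_rightMul_comm, hvη, ← T.rightMul_mul, hv2, rightMul_one,
      one_apply_eq_self]
  have hnorm : ∀ z, ‖T.leftMul v (T.rightMul (star v) z)‖ = ‖z‖ := fun z => by
    rw [T.norm_leftMul_apply hv1, T.norm_rightMul_apply (by rwa [star_star])]
  have h := hfix (fun z => T.leftMul v (T.rightMul (star v) z)) ?_ fun z => (hnorm z).le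
  · simp only [rightMul_hat, leftMul_hat] at h
    have h' := T.hat_injective h
    calc v * y = v * (y * star v) * v := by simp [mul_assoc, hv1]
      _ = y * v := by rw [h']
  · rintro _ ⟨⟨z, hz, rfl⟩, hzη⟩
    refine ⟨⟨v * (z * star v), ?_, by simp⟩, ?_⟩
    · rw [mem_closedBall_zero_iff] at hz ⊢
      refine (norm_mul_le _ _).trans ?_
      rw [CStarRing.norm_of_mem_unitary hv, one_mul]
      refine (norm_mul_le _ _).trans ?_
      rwa [norm_star, CStarRing.norm_of_mem_unitary hv, mul_one]
    · rw [Metric.mem_closedBall, dist_eq_norm] at hzη ⊢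
      have e : T.leftMul v (T.rightMul (star v) (T.hat z)) - η =
          T.leftMul v (T.rightMul (star v) (T.hat z - η)) := by rw [map_sub, map_sub, hη]
      rwa [e, hnorm]

end TracialVNA

namespace TracialVNA

variable {H : Type u} [NormedAddCommGroup H] [InnerProductSpace ℂ H] [CompleteSpace H]
variable (T : TracialVNA H)

theorem leftMul_add (x y : T.Elt) : T.leftMul (x + y) = T.leftMul x + T.leftMul y :=
  T.clm_ext fun z => by simp [add_mul, hat_add]

theorem leftMul_smul (c : ℂ) (x : T.Elt) : T.leftMul (c • x) = c • T.leftMul x :=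
  T.clm_ext fun z => by simp [hat_smul]

end TracialVNA

/-! ### Closedness of operator norm balls in `L²(P ⋊ Γ)`. -/

/-- An `ε/3` argument: the uniform bound makes the sequence equicontinuous. This lets pointwise
convergence be checked on a total set of vectors. -/
theorem isClosed_setOf_cauchySeq_apply {E F : Type*} [SeminormedAddCommGroup E] [NormedSpace ℂ E]
    [SeminormedAddCommGroup F] [NormedSpace ℂ F] {x : ℕ → E →L[ℂ] F} {r : ℝ}
    (hx : ∀ n, ‖x n‖ ≤ r) : IsClosed {ξ | CauchySeq fun n => x n ξ} := by
  have hr : 0 ≤ r := (norm_nonneg _).trans (hx 0)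
  refine isClosed_of_closure_subset fun ξ hξ => Metric.cauchySeq_iff.2 fun ε hε => ?_
  obtain ⟨ζ, hζ, hd⟩ := Metric.mem_closure_iff.1 hξ (ε / (3 * (r + 1))) (by positivity)
  obtain ⟨N, hN⟩ := Metric.cauchySeq_iff.1 hζ (ε / 3) (by positivity)
  refine ⟨N, fun k hk l hl => ?_⟩
  have key : ∀ n, dist (x n ξ) (x n ζ) < ε / 3 := fun n => by
    rw [dist_eq_norm, ← map_sub]
    rw [dist_eq_norm] at hd
    calc ‖x n (ξ - ζ)‖ ≤ r * ‖ξ - ζ‖ := (x n).le_of_opNorm_le (hx n) _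
      _ ≤ (r + 1) * ‖ξ - ζ‖ := by gcongr; linarith
      _ < (r + 1) * (ε / (3 * (r + 1))) := by gcongr
      _ = ε / 3 := by field_simp
  have h1 := dist_triangle4 (x k ξ) (x k ζ) (x l ζ) (x l ξ)
  have h2 := key l
  rw [dist_comm] at h2
  linarith [key k, hN k hk l hl]

namespace TracePreservingAction

open EllTwo

variable {Γ : Type v} [Group Γ] {H : Type u} [NormedAddCommGroup H]
  [InnerProductSpace ℂ H] [CompleteSpace H] {P : TracialVNA H} (σ : TracePreservingAction Γ P)

/-- The trace is the vector state of `Ω`, so convergence in `L²(P ⋊ Γ)` amounts to convergence at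
the single vector `Ω`. -/
theorem norm_hat (x : σ.crossedProduct.Elt) :
    ‖σ.crossedProduct.hat x‖ = ‖x.1 (vacuum Γ P)‖ := by
  refine (sq_eq_sq₀ (norm_nonneg _) (norm_nonneg _)).1 ?_
  have h : ⟪σ.crossedProduct.hat x, σ.crossedProduct.hat x⟫_ℂ =
      ⟪x.1 (vacuum Γ P), x.1 (vacuum Γ P)⟫_ℂ := by
    rw [σ.crossedProduct.inner_hat]
    change ⟪vacuum Γ P, star x.1 (x.1 (vacuum Γ P))⟫_ℂ = _
    rw [ContinuousLinearMap.star_eq_adjoint, ContinuousLinearMap.adjoint_inner_right]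
  rw [inner_self_eq_norm_sq_to_K, inner_self_eq_norm_sq_to_K] at h
  exact_mod_cast h

theorem norm_hat_sub (x y : σ.crossedProduct.Elt) :
    ‖σ.crossedProduct.hat x - σ.crossedProduct.hat y‖ =
      ‖x.1 (vacuum Γ P) - y.1 (vacuum Γ P)‖ := by
  have := σ.norm_hat (x - y)
  rwa [TracialVNA.hat_sub] at this

/-- The vector `δ_s ⊗ ŷ` is the image of `Ω` under an operator in the commutant. -/
theorem apply_delta {Λ : Subgroup Γ} {x : EllTwo Γ P.L2 →L[ℂ] EllTwo Γ P.L2}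
    (hx : x ∈ σ.subCrossed Λ) (s : Γ) (y : P.Elt) :
    x (delta s (P.hat y)) = rightRep Γ y (σ.rightU s⁻¹ (x (vacuum Γ P))) := by
  have e : delta s (P.hat y) = rightRep Γ y (σ.rightU s⁻¹ (vacuum Γ P)) := by
    simp [vacuum, rightU_delta, rightRep_delta]
  have h1 := congrArg (fun f => f (σ.rightU s⁻¹ (vacuum Γ P))) (σ.rightRep_comm y hx)
  have h2 := congrArg (fun f => f (vacuum Γ P)) (σ.rightU_comm s⁻¹ hx)
  simp only [mul_apply_eq_comp] at h1 h2
  rw [e, ← h1, ← h2]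

/-- The balls of `P ⋊ Γ` are closed in `L²(P ⋊ Γ)`. -/
theorem isClosed_hat_closedBall (r : ℝ) :
    IsClosed (σ.crossedProduct.hat '' Metric.closedBall 0 r) := by
  refine IsSeqClosed.isClosed fun s ζ hs hζ => ?_
  choose x hx hxs using hs
  simp only [mem_closedBall_zero_iff] at hx
  have hΩ : CauchySeq fun n => (x n).1 (vacuum Γ P) := by
    refine Metric.cauchySeq_iff.2 fun ε hε => ?_
    obtain ⟨N, hN⟩ := Metric.cauchySeq_iff.1 hζ.cauchySeq ε hε
    refine ⟨N, fun k hk l hl => ?_⟩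
    rw [dist_eq_norm, ← norm_hat_sub, hxs, hxs, ← dist_eq_norm]
    exact hN k hk l hl
  have hx' : ∀ n, ‖(x n).1‖ ≤ r := hx
  -- Convergence at `Ω` spreads to every `δ_s ⊗ ŷ`, because these are images of `Ω` under operators
  -- commuting with all `x n`; boundedness then gives convergence everywhere.
  let V : Submodule ℂ (EllTwo Γ P.L2) :=
    { carrier := {ξ | CauchySeq fun n => (x n).1 ξ}
      add_mem' := fun {ξ η} hξ hη => by
        simpa [Pi.add_def] using CauchySeq.add (u := fun n => (x n).1 ξ) hξ hη
      zero_mem' := by simpa using cauchySeq_const (0 : EllTwo Γ P.L2)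
      smul_mem' := fun c ξ hξ => by
        have := (uniformContinuous_const_smul (M := ℂ) (X := EllTwo Γ P.L2) c).comp_cauchySeq hξ
        simpa [Function.comp_def] using this }
  have hall : ∀ ξ, CauchySeq fun n => (x n).1 ξ :=
    mem_of_hat_mem V (isClosed_setOf_cauchySeq_apply hx') fun s y => by
      change CauchySeq fun n => (x n).1 (delta s (P.hat y))
      have := ((rightRep Γ y).comp (σ.rightU s⁻¹)).uniformContinuous.comp_cauchySeq hΩ
      simpa [Function.comp_def, σ.apply_delta (x _).2] using this
  choose f hf using fun ξ => cauchySeq_tendsto_of_complete (hall ξ)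
  let t : EllTwo Γ P.L2 →L[ℂ] EllTwo Γ P.L2 :=
    continuousLinearMapOfTendsto (fun n => (x n).1) (tendsto_pi_nhds.2 hf)
  have ht : ∀ ξ, Filter.Tendsto (fun n => (x n).1 ξ) Filter.atTop (nhds (t ξ)) := hf
  -- Commutation with a fixed operator passes to pointwise limits, so the bicommutant contains `t`.
  have htM : t ∈ σ.subCrossed ⊤ := by
    refine VonNeumannAlgebra.mem_generatedBy_iff.2 fun y hy => ?_
    ext1 ξ
    have h1 := (y.continuous.tendsto _).comp (ht ξ)
    refine tendsto_nhds_unique h1 ((ht (y ξ)).congr fun n => ?_)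
    exact (congrArg (fun g => g ξ) (VonNeumannAlgebra.mem_generatedBy_iff.1 (x n).2 y hy)).symm
  have htr : ‖t‖ ≤ r := by
    refine t.opNorm_le_bound ((norm_nonneg _).trans (hx 0)) fun ξ => ?_
    exact le_of_tendsto (ht ξ).norm (Filter.Eventually.of_forall fun n =>
      (x n).1.le_of_opNorm_le (hx' n) ξ)
  refine ⟨⟨t, htM⟩, by rw [mem_closedBall_zero_iff]; exact htr, tendsto_nhds_unique ?_ hζ⟩
  rw [tendsto_iff_norm_sub_tendsto_zero]
  refine (tendsto_iff_norm_sub_tendsto_zero.1 (ht (vacuum Γ P))).congr fun n => ?_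
  rw [← hxs, norm_hat_sub]

/-! ### Algebraic relations in the crossed product. -/

theorem rep_mul (x y : P.Elt) : σ.rep (x * y) = σ.rep x * σ.rep y := by
  ext ξ s
  simp [rep, P.leftMul_mul]

theorem rep_one : σ.rep 1 = 1 := by
  ext ξ s
  simp [rep]

/-- The embedding of `P` into `P ⋊ Γ`. -/
noncomputable def repElt : P.Elt →ₗ[ℂ] σ.crossedProduct.Elt where
  toFun p := ⟨σ.rep p, σ.rep_mem _ p⟩
  map_add' x y := Subtype.ext (by ext ξ s; simp [rep, P.leftMul_add])
  map_smul' c x := Subtype.ext (by ext ξ s; simp [rep, P.leftMul_smul])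

theorem star_repElt (p : P.Elt) : star (σ.repElt p) = σ.repElt (star p) :=
  Subtype.ext (σ.star_rep p)

theorem repElt_mul (p q : P.Elt) : σ.repElt (p * q) = σ.repElt p * σ.repElt q :=
  Subtype.ext (σ.rep_mul p q)

theorem repElt_one : σ.repElt 1 = 1 := Subtype.ext σ.rep_one

theorem star_uElt (g : Γ) : star (σ.uElt g) = σ.uElt g⁻¹ := Subtype.ext (star_u g)

theorem uElt_mul (g h : Γ) : σ.uElt (g * h) = σ.uElt g * σ.uElt h := by
  refine Subtype.ext ?_
  change u (g * h) = u g * u h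
  ext ξ s
  simp [u]

theorem uElt_one : σ.uElt 1 = 1 := by
  refine Subtype.ext ?_
  change u 1 = 1
  ext ξ s
  simp [u]

theorem uElt_mul_inv (g : Γ) : σ.uElt g * σ.uElt g⁻¹ = 1 := by
  rw [← uElt_mul, mul_inv_cancel, uElt_one]

theorem uElt_inv_mul (g : Γ) : σ.uElt g⁻¹ * σ.uElt g = 1 := by
  rw [← uElt_mul, inv_mul_cancel, uElt_one]

theorem uElt_mul_repElt (g : Γ) (p : P.Elt) :
    σ.uElt g * σ.repElt p = σ.repElt (σ.aut g p) * σ.uElt g := by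
  refine Subtype.ext ?_
  change u g * σ.rep p = σ.rep (σ.aut g p) * u g
  ext ξ s
  simp [u, rep]

theorem repElt_mem_unitary {p : P.Elt} (hp : p ∈ unitary P.Elt) :
    σ.repElt p ∈ unitary σ.crossedProduct.Elt := by
  obtain ⟨h1, h2⟩ := Unitary.mem_iff.1 hp
  rw [Unitary.mem_iff, star_repElt, ← repElt_mul, ← repElt_mul, h1, h2, repElt_one]
  exact ⟨rfl, rfl⟩

theorem uElt_mem_unitary (g : Γ) : σ.uElt g ∈ unitary σ.crossedProduct.Elt := by
  rw [Unitary.mem_iff, star_uElt, uElt_mul_inv, uElt_inv_mul]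
  exact ⟨rfl, rfl⟩

/-! ### From irreducibility in `M` to central vectors in `L²(M)`. -/

/-- If `P ⋊ Λ ⊆ P ⋊ Γ` is irreducible, then the only vectors of `L²(P ⋊ Γ)` that commute with `P`
and with the unitaries `u_g`, `g ∈ Λ`, are the scalars. -/
theorem eq_smul_hat_one_of_central {Λ : Subgroup Γ}
    (hirr : (σ.subCrossed Λ).IsIrreducibleIn σ.crossedProduct.alg) (η : σ.crossedProduct.L2)
    (hP : ∀ p, σ.crossedProduct.leftMul (σ.repElt p) η = σ.crossedProduct.rightMul (σ.repElt p) η)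
    (hΛ : ∀ k ∈ Λ, σ.crossedProduct.leftMul (σ.uElt k) η =
      σ.crossedProduct.rightMul (σ.uElt k) η) :
    ∃ c : ℂ, η = c • σ.crossedProduct.hat 1 := by
  have hmem : η ∈ Submodule.span ℂ {σ.crossedProduct.hat 1} := by
    have hc : IsClosed (Submodule.span ℂ {σ.crossedProduct.hat 1} : Set σ.crossedProduct.L2) :=
      Submodule.closed_of_finiteDimensional _
    rw [← SetLike.mem_coe, ← hc.closure_eq, Metric.mem_closure_iff]
    intro ε hε
    obtain ⟨y, hyη, hy⟩ := σ.crossedProduct.exists_commuting_approx σ.isClosed_hat_closedBall η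
      (half_pos hε)
    have hyP : ∀ p, σ.repElt p * y = y * σ.repElt p := by
      intro p
      -- The approximant is only known to commute with unitaries; these span `P`.
      have hp : p ∈ Submodule.span ℂ (unitary P.Elt : Set P.Elt) := by
        rw [CStarAlgebra.span_unitary]; trivial
      induction hp using Submodule.span_induction with
      | mem p hp => exact hy _ (σ.repElt_mem_unitary hp) (hP p)
      | zero => simp
      | add p q _ _ h1 h2 => rw [map_add, add_mul, mul_add, h1, h2]
      | smul c p _ h1 => rw [map_smul, smul_mul_assoc, mul_smul_comm, h1]
    have hyΛ : ∀ k ∈ Λ, σ.uElt k * y = y * σ.uElt k := fun k hk =>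
      hy _ (σ.uElt_mem_unitary k) (hΛ k hk)
    obtain ⟨c, hcy⟩ := hirr.2 y.1 y.2 fun a ha => by
      refine (VonNeumannAlgebra.mem_generatedBy_iff.1 ha y.1 ?_).symm
      rintro _ (⟨p, rfl⟩ | ⟨k, hk, rfl⟩)
      · rw [star_rep]
        exact ⟨congrArg Subtype.val (hyP p), congrArg Subtype.val (hyP (star p))⟩
      · rw [star_u]
        exact ⟨congrArg Subtype.val (hyΛ k hk), congrArg Subtype.val (hyΛ _ (Λ.inv_mem hk))⟩
    have hcy' : y = c • 1 := Subtype.ext hcy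
    refine ⟨_, Submodule.mem_span_singleton.2 ⟨c, rfl⟩, ?_⟩
    rw [dist_comm, dist_eq_norm, ← TracialVNA.hat_smul, ← hcy']
    exact hyη.trans_lt (half_lt_self hε)
  obtain ⟨c, hc⟩ := Submodule.mem_span_singleton.1 hmem
  exact ⟨c, hc.symm⟩

end TracePreservingAction

/-! ### Subbimodules, projections and intertwiners. -/

/-- Invariance of `L` under `star f` makes `Lᗮ` invariant under `f`, so `f` respects the
decomposition `L ⊕ Lᗮ`. -/
theorem Submodule.starProjection_apply_comm {E : Type*} [NormedAddCommGroup E]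
    [InnerProductSpace ℂ E] [CompleteSpace E] (L : Submodule ℂ E) [L.HasOrthogonalProjection]
    (f : E →L[ℂ] E) (hf : ∀ ξ ∈ L, f ξ ∈ L) (hf' : ∀ ξ ∈ L, star f ξ ∈ L) (ξ : E) :
    L.starProjection (f ξ) = f (L.starProjection ξ) := by
  refine L.eq_starProjection_of_mem_of_inner_eq_zero
    (hf _ (L.starProjection_apply_mem ξ)) fun w hw => ?_
  rw [← map_sub, ← ContinuousLinearMap.adjoint_inner_right, ← ContinuousLinearMap.star_eq_adjoint]
  exact L.starProjection_inner_eq_zero ξ _ (hf' w hw)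

namespace L2Subbimodule

variable {H : Type u} [NormedAddCommGroup H] [InnerProductSpace ℂ H] [CompleteSpace H]
  {M : TracialVNA H} {N : VonNeumannAlgebra H}

/-- The orthogonal complement of a bimodule. -/
noncomputable def orthogonal (L : L2Subbimodule M N) : L2Subbimodule M N where
  carrier := L.carrierᗮ
  isClosed := Submodule.isClosed_orthogonal _
  left_mem x hx ξ hξ := by
    rw [Submodule.mem_orthogonal] at hξ ⊢
    intro η hη
    rw [← ContinuousLinearMap.adjoint_inner_left, ← ContinuousLinearMap.star_eq_adjoint,
      M.star_leftMul]
    exact hξ _ (L.left_mem (star x) (star_mem hx) η hη)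
  right_mem x hx ξ hξ := by
    rw [Submodule.mem_orthogonal] at hξ ⊢
    intro η hη
    rw [← ContinuousLinearMap.adjoint_inner_left, ← ContinuousLinearMap.star_eq_adjoint,
      M.star_rightMul]
    exact hξ _ (L.right_mem (star x) (star_mem hx) η hη)

theorem starProjection_leftMul (L : L2Subbimodule M N) [L.carrier.HasOrthogonalProjection]
    {x : M.Elt} (hx : x.1 ∈ N) (ξ : M.L2) :
    L.carrier.starProjection (M.leftMul x ξ) = M.leftMul x (L.carrier.starProjection ξ) :=
  L.carrier.starProjection_apply_comm _ (L.left_mem x hx)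
    (by rw [M.star_leftMul]; exact L.left_mem (star x) (star_mem hx)) ξ

theorem starProjection_rightMul (L : L2Subbimodule M N) [L.carrier.HasOrthogonalProjection]
    {x : M.Elt} (hx : x.1 ∈ N) (ξ : M.L2) :
    L.carrier.starProjection (M.rightMul x ξ) = M.rightMul x (L.carrier.starProjection ξ) :=
  L.carrier.starProjection_apply_comm _ (L.right_mem x hx)
    (by rw [M.star_rightMul]; exact L.right_mem (star x) (star_mem hx)) ξ

theorem closedSpan_le {w : M.Elt} {L : L2Subbimodule M N} (hw : M.hat w ∈ L.carrier) :
    (closedSpan N w).carrier ≤ L.carrier := by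
  refine Submodule.topologicalClosure_minimal _ (Submodule.span_le.2 ?_) L.isClosed
  rintro _ ⟨x, y, hx, hy, rfl⟩
  simpa using L.right_mem y hy _ (L.left_mem x hx _ hw)

theorem mul_mem_closedSpan {w x y : M.Elt} (hx : x.1 ∈ N) (hy : y.1 ∈ N) :
    M.hat (x * w * y) ∈ (closedSpan N w).carrier :=
  Submodule.le_topologicalClosure _ (Submodule.subset_span ⟨x, y, hx, hy, rfl⟩)

theorem mem_closedSpan (N : VonNeumannAlgebra H) (w : M.Elt) :
    M.hat w ∈ (closedSpan N w).carrier := by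
  have := mul_mem_closedSpan (N := N) (w := w) (x := 1) (y := 1) (one_mem N) (one_mem N)
  simpa using this

theorem carrier_injective :
    Function.Injective (carrier : L2Subbimodule M N → Submodule ℂ M.L2) := by
  rintro ⟨⟩ ⟨⟩ rfl
  rfl

theorem Iso.refl (K : L2Subbimodule M N) : K.Iso K :=
  ⟨LinearIsometryEquiv.refl ℂ _, fun _ _ _ => ⟨rfl, rfl⟩⟩

/-- The bimodule generated by `w` is irreducible if every vector `ξ` satisfying the relations
`y ξ = ξ x` that hold for `w` is a multiple of `w`. -/
theorem isIrreducible_closedSpan {w : M.Elt} (hw : w ≠ 0)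
    (h : ∀ ξ : M.L2, (∀ x y : M.Elt, x.1 ∈ N → y.1 ∈ N → y * w = w * x →
      M.leftMul y ξ = M.rightMul x ξ) → ∃ c : ℂ, ξ = c • M.hat w) :
    (closedSpan N w).IsIrreducible := by
  refine ⟨fun hbot => hw (M.hat_injective ?_), fun L hL => ?_⟩
  · have h0 := mem_closedSpan N w
    rw [hbot, Submodule.mem_bot] at h0
    rw [h0]
    exact (map_zero M.hatLinear).symm
  have : CompleteSpace L.carrier := L.isClosed.completeSpace_coe
  -- The projection is a bimodule map, so the projected vector inherits every relation of `w`.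
  obtain ⟨c, hc⟩ := h (L.carrier.starProjection (M.hat w)) fun x y hx hy hxy => by
    rw [← L.starProjection_leftMul hy, ← L.starProjection_rightMul hx, M.leftMul_hat,
      M.rightMul_hat, hxy]
  have hmem := L.carrier.starProjection_apply_mem (M.hat w)
  rcases eq_or_ne c 0 with rfl | hc0
  · left
    -- Here `ŵ ⟂ L`, so the whole bimodule generated by `w` lies in `Lᗮ`; as it contains `L`, `L` is
    -- orthogonal to itself.
    rw [zero_smul, Submodule.starProjection_apply_eq_zero_iff] at hc
    have h1 := closedSpan_le (L := L.orthogonal) hc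
    exact Submodule.isOrtho_self.1 (hL.trans h1)
  · right
    refine le_antisymm hL (closedSpan_le ?_)
    rw [hc] at hmem
    exact (Submodule.smul_mem_iff _ hc0).1 hmem

/-- If every vector `ξ` satisfying the relations `y ξ = ξ x` that hold for `w` is a multiple of
`w`, then an isomorphism from the bimodule generated by `w` has range containing `w`. -/
theorem Iso.hat_mem {w : M.Elt} (hw : w ≠ 0)
    (h : ∀ ξ : M.L2, (∀ x y : M.Elt, x.1 ∈ N → y.1 ∈ N → y * w = w * x →
      M.leftMul y ξ = M.rightMul x ξ) → ∃ c : ℂ, ξ = c • M.hat w)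
    {L : L2Subbimodule M N} (hL : (closedSpan N w).Iso L) : M.hat w ∈ L.carrier := by
  obtain ⟨U, hU⟩ := hL
  let ω : (closedSpan N w).carrier := ⟨M.hat w, mem_closedSpan N w⟩
  obtain ⟨c, hc⟩ := h (U ω) fun x y hx hy hxy => by
    rw [← (hU y hy ω).1, ← (hU x hx ω).2]
    congr 3
    simp [ω, hxy]
  have hmem := (U ω).2
  rw [hc] at hmem
  refine (Submodule.smul_mem_iff _ fun hc0 => hw (M.hat_injective ?_)).1 hmem
  rw [hc0, zero_smul, Submodule.coe_eq_zero, map_eq_zero_iff _ U.injective] at hc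
  exact (congrArg Subtype.val hc).trans (map_zero M.hatLinear).symm

end L2Subbimodule

/-! ### Supports on double cosets, and rigidity of `û_g`. -/

namespace TracePreservingAction

open EllTwo L2Subbimodule

variable {Γ : Type v} [Group Γ] {H : Type u} [NormedAddCommGroup H]
  [InnerProductSpace ℂ H] [CompleteSpace H] {P : TracialVNA H} (σ : TracePreservingAction Γ P)

/-- `P ⋊ Z` preserves the vectors supported on a union of right cosets of `Z`. -/
theorem apply_eq_zero_of_support {Z : Subgroup Γ} {x : EllTwo Γ P.L2 →L[ℂ] EllTwo Γ P.L2}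
    (hx : x ∈ σ.subCrossed Z) {S : Set Γ} (hS : ∀ k ∈ Z, ∀ s ∈ S, k * s ∈ S)
    {ξ : EllTwo Γ P.L2} (hξ : ∀ s ∉ S, ξ s = 0) {s : Γ} (hs : s ∉ S) : x ξ s = 0 := by
  classical
  -- The projection onto vectors supported on `S`. Since `S` is stable under left translation by
  -- `Z`, it commutes with the generators of `P ⋊ Z`.
  let p : EllTwo Γ P.L2 →L[ℂ] EllTwo Γ P.L2 :=
    op (Equiv.refl Γ) (fun s => if s ∈ S then 1 else 0) 1 fun s => by
      split_ifs
      · exact ContinuousLinearMap.norm_id_le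
      · simp
  have hu : ∀ k ∈ Z, u k * p = p * u k := fun k hk => by
    ext η t
    have e : k⁻¹ * t ∈ S ↔ t ∈ S :=
      ⟨fun h => by simpa using hS k hk _ h, hS _ (Z.inv_mem hk) t⟩
    by_cases ht : t ∈ S <;> simp [p, u, e, ht]
  have hr : ∀ z, σ.rep z * p = p * σ.rep z := fun z => by
    ext η t
    by_cases ht : t ∈ S <;> simp [p, rep, ht]
  have hp : p * x = x * p := by
    refine VonNeumannAlgebra.mem_generatedBy_iff.1 hx p ?_
    rintro _ (⟨z, rfl⟩ | ⟨k, hk, rfl⟩)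
    · exact ⟨hr z, by rw [star_rep, hr]⟩
    · exact ⟨hu k hk, by rw [star_u, hu _ (Z.inv_mem hk)]⟩
  have hpξ : p ξ = ξ := by
    ext t
    by_cases ht : t ∈ S
    · simp [p, ht]
    · simp [p, ht, hξ t ht]
  have h := congrArg (fun f => f ξ s) hp
  simp only [mul_apply_eq_comp, hpξ] at h
  rw [← h]
  simp [p, hs]

/-- The bimodule generated by `u_h` is supported on the double coset `Z h Z`. -/
theorem mem_doubleCoset_of_mem_closedSpan {Z : Subgroup Γ} {g h : Γ}
    (hg : σ.crossedProduct.hat (σ.uElt g) ∈ (closedSpan (σ.subCrossed Z) (σ.uElt h)).carrier) :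
    g ∈ DoubleCoset.doubleCoset h (Z : Set Γ) Z := by
  by_contra hgh
  have hort : (closedSpan (σ.subCrossed Z) (σ.uElt h)).carrier ≤
      (ℂ ∙ σ.crossedProduct.hat (σ.uElt g))ᗮ := by
    refine Submodule.topologicalClosure_minimal _ (Submodule.span_le.2 ?_)
      (Submodule.isClosed_orthogonal _)
    rintro _ ⟨x, y, hx, hy, rfl⟩
    rw [SetLike.mem_coe, Submodule.mem_orthogonal_singleton_iff_inner_right,
      σ.crossedProduct.inner_hat]
    change ⟪vacuum Γ P, star (u g) (x.1 (u h (y.1 (vacuum Γ P))))⟫_ℂ = 0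
    rw [ContinuousLinearMap.star_eq_adjoint, ContinuousLinearMap.adjoint_inner_right, vacuum,
      u_delta, lp.inner_eq_tsum]
    -- `y Ω` is supported on `Z`, so `u_h y Ω` is supported on `h Z` and `x u_h y Ω` on `Z h Z`,
    -- which misses `g`; but `u_g Ω` lives at `g`.
    have hy' : ∀ s ∉ (Z : Set Γ), y.1 (delta 1 (P.hat 1)) s = 0 := fun s hs =>
      σ.apply_eq_zero_of_support hy (S := Z) (fun k hk s hs => Z.mul_mem hk hs)
        (fun s hs => delta_ne (by rintro rfl; exact hs Z.one_mem) _) hs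
    have hx' : x.1 (u h (y.1 (delta 1 (P.hat 1)))) g = 0 := by
      refine σ.apply_eq_zero_of_support hx (S := DoubleCoset.doubleCoset h (Z : Set Γ) Z)
        (fun k hk s hs => ?_) (fun s hs => ?_) hgh
      · obtain ⟨i, hi, j, hj, rfl⟩ := DoubleCoset.mem_doubleCoset.1 hs
        exact DoubleCoset.mem_doubleCoset.2 ⟨k * i, Z.mul_mem hk hi, j, hj, by simp [mul_assoc]⟩
      · refine hy' (h⁻¹ * s) fun hs' => hs ?_
        exact DoubleCoset.mem_doubleCoset.2 ⟨1, Z.one_mem, h⁻¹ * s, hs', by simp⟩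
    refine (tsum_congr fun s => ?_).trans tsum_zero
    by_cases hs : s = g
    · rw [hs, hx', inner_zero_right]
    · rw [delta_ne (by simpa using hs), inner_zero_left]
  have h0 := (Submodule.mem_orthogonal_singleton_iff_inner_right).1 (hort hg)
  rw [σ.crossedProduct.inner_hat, (Unitary.mem_iff.1 (σ.uElt_mem_unitary g)).1,
    σ.crossedProduct.trace_one] at h0
  exact one_ne_zero h0

/-- If `g = i h j` with `i, j ∈ Z`, then `u_g = u_i u_h u_j` with `u_i, u_j ∈ P ⋊ Z`. -/
theorem closedSpan_le_of_mem_doubleCoset {Z : Subgroup Γ} {g h : Γ}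
    (hgh : g ∈ DoubleCoset.doubleCoset h (Z : Set Γ) Z) :
    (closedSpan (σ.subCrossed Z) (σ.uElt g)).carrier ≤
      (closedSpan (σ.subCrossed Z) (σ.uElt h)).carrier := by
  obtain ⟨i, hi, j, hj, rfl⟩ := DoubleCoset.mem_doubleCoset.1 hgh
  refine closedSpan_le ?_
  rw [uElt_mul, uElt_mul]
  exact mul_mem_closedSpan (σ.u_mem hi) (σ.u_mem hj)

/-- If `P ⋊ Λ ⊆ P ⋊ Γ` is irreducible, where `Λ ⊆ Z ∩ g⁻¹ Z g`, then the multiples of `u_g` are the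
only vectors `ξ` satisfying the relations `y ξ = ξ x`, `x, y ∈ P ⋊ Z`, that hold for `u_g`. -/
theorem eq_smul_hat_uElt {Λ Z : Subgroup Γ}
    (hirr : (σ.subCrossed Λ).IsIrreducibleIn σ.crossedProduct.alg) {g : Γ} (hΛ : Λ ≤ Z)
    (hg : ∀ k ∈ Λ, g * k * g⁻¹ ∈ Z) (ξ : σ.crossedProduct.L2)
    (hξ : ∀ x y : σ.crossedProduct.Elt, x.1 ∈ σ.subCrossed Z → y.1 ∈ σ.subCrossed Z →
      y * σ.uElt g = σ.uElt g * x →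
      σ.crossedProduct.leftMul y ξ = σ.crossedProduct.rightMul x ξ) :
    ∃ c : ℂ, ξ = c • σ.crossedProduct.hat (σ.uElt g) := by
  -- With `η = u_g⁻¹ ξ`, the relation reads `x u_g⁻¹ = u_g⁻¹ y`, whence `x η = u_g⁻¹ y ξ = u_g⁻¹ ξ x
  -- = η x`.
  have key : ∀ x y : σ.crossedProduct.Elt, x.1 ∈ σ.subCrossed Z → y.1 ∈ σ.subCrossed Z →
      y * σ.uElt g = σ.uElt g * x →
      σ.crossedProduct.leftMul x (σ.crossedProduct.leftMul (σ.uElt g⁻¹) ξ) =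
        σ.crossedProduct.rightMul x (σ.crossedProduct.leftMul (σ.uElt g⁻¹) ξ) := by
    intro x y hx hy hxy
    have e : x * σ.uElt g⁻¹ = σ.uElt g⁻¹ * y := by
      calc x * σ.uElt g⁻¹ = σ.uElt g⁻¹ * (σ.uElt g * x) * σ.uElt g⁻¹ := by
            rw [← mul_assoc, uElt_inv_mul, one_mul]
        _ = σ.uElt g⁻¹ * y := by
            rw [← hxy, mul_assoc, mul_assoc, uElt_mul_inv, mul_one]
    rw [← TracialVNA.leftMul_mul, e, TracialVNA.leftMul_mul, hξ x y hx hy hxy,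
      TracialVNA.leftMul_rightMul_comm]
  obtain ⟨c, hc⟩ := σ.eq_smul_hat_one_of_central hirr (σ.crossedProduct.leftMul (σ.uElt g⁻¹) ξ)
    (fun p => key _ (σ.repElt (σ.aut g p)) (σ.rep_mem _ p) (σ.rep_mem _ _)
      (σ.uElt_mul_repElt g p).symm)
    fun k hk => key _ (σ.uElt (g * k * g⁻¹)) (σ.u_mem (hΛ hk)) (σ.u_mem (hg k hk))
      (by rw [← uElt_mul, ← uElt_mul, inv_mul_cancel_right])
  refine ⟨c, ?_⟩
  have h := congrArg (σ.crossedProduct.leftMul (σ.uElt g)) hc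
  rwa [← TracialVNA.leftMul_mul, uElt_mul_inv, TracialVNA.leftMul_one, map_smul,
    TracialVNA.leftMul_hat, mul_one, one_apply_eq_self] at h

theorem uElt_ne_zero (g : Γ) : σ.uElt g ≠ 0 := fun h => by
  have := σ.uElt_mul_inv g
  rw [h, zero_mul] at this
  exact zero_ne_one this

end TracePreservingAction

/-! ### The left index in the Baumslag-Solitar group, and the conclusion. -/

/-- `g ⟨a ^ l⟩ g⁻¹ ⊆ ⟨a⟩` for the left index `l = l(g)`. -/
theorem BaumslagSolitar.conj_mem_zpowers {n m : ℤ} (g : BaumslagSolitar n m)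
    {k : BaumslagSolitar n m} (hk : k ∈ Subgroup.zpowers (a n m ^ l g)) :
    g * k * g⁻¹ ∈ Subgroup.zpowers (a n m) := by
  -- In the abelian group `⟨a⟩` every subgroup is normal, so the power of `a` by the index lies in
  -- `⟨a⟩ ∩ g⁻¹⟨a⟩g`. An infinite index would be recorded as `0`, giving the trivial power.
  have h1 : a n m ^ l g ∈
      (Subgroup.zpowers (a n m)).map (MulAut.conj g⁻¹).toMonoidHom :=
    (((Subgroup.zpowers (a n m)).map (MulAut.conj g⁻¹).toMonoidHom).subgroupOf
      (Subgroup.zpowers (a n m))).pow_index_mem ⟨a n m, Subgroup.mem_zpowers _⟩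
  obtain ⟨z, hz, rfl⟩ := (Subgroup.zpowers_le.2 h1) hk
  simpa [mul_assoc] using hz

theorem lemma4p1 {n m : ℤ} (hn : 2 ≤ n) (hnm : n ≤ |m|)
    {H : Type*} [NormedAddCommGroup H] [InnerProductSpace ℂ H] [CompleteSpace H]
    (P : TracialVNA H) (σ : TracePreservingAction (BaumslagSolitar n m) P)
    (hirr : ∀ g : BaumslagSolitar n m,
      (σ.subCrossed (Subgroup.zpowers (BaumslagSolitar.a n m ^ BaumslagSolitar.l g))).IsIrreducibleIn
        σ.crossedProduct.alg) :
    (∀ g : BaumslagSolitar n m,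
      (L2Subbimodule.closedSpan (σ.subCrossed (Subgroup.zpowers (BaumslagSolitar.a n m)))
        (σ.uElt g)).IsIrreducible) ∧
    ∀ g h : BaumslagSolitar n m,
      (L2Subbimodule.closedSpan (σ.subCrossed (Subgroup.zpowers (BaumslagSolitar.a n m)))
        (σ.uElt g)).Iso
        (L2Subbimodule.closedSpan (σ.subCrossed (Subgroup.zpowers (BaumslagSolitar.a n m)))
          (σ.uElt h)) ↔
      DoubleCoset.doubleCoset g (Subgroup.zpowers (BaumslagSolitar.a n m) : Set (BaumslagSolitar n m))
          (Subgroup.zpowers (BaumslagSolitar.a n m)) =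
        DoubleCoset.doubleCoset h (Subgroup.zpowers (BaumslagSolitar.a n m))
          (Subgroup.zpowers (BaumslagSolitar.a n m)) := by
  have key := fun g : BaumslagSolitar n m =>
    σ.eq_smul_hat_uElt (hirr g) (Subgroup.zpowers_le.2 (pow_mem (Subgroup.mem_zpowers _) _))
      fun k => BaumslagSolitar.conj_mem_zpowers g
  refine ⟨fun g => L2Subbimodule.isIrreducible_closedSpan (σ.uElt_ne_zero g) (key g),
    fun g h => ⟨fun hgh => ?_, fun hgh => ?_⟩⟩
  · exact DoubleCoset.doubleCoset_eq_of_mem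
      (σ.mem_doubleCoset_of_mem_closedSpan (hgh.hat_mem (σ.uElt_ne_zero g) (key g)))
  · have hle := σ.closedSpan_le_of_mem_doubleCoset
      (hgh ▸ DoubleCoset.mem_doubleCoset_self (Subgroup.zpowers (BaumslagSolitar.a n m)) _ g)
    have hge := σ.closedSpan_le_of_mem_doubleCoset
      (hgh.symm ▸ DoubleCoset.mem_doubleCoset_self (Subgroup.zpowers (BaumslagSolitar.a n m)) _ h)
    -- Equal double cosets give the same subspace of `L²(M)`, so the identity serves as the
    -- isomorphism.
    rw [L2Subbimodule.carrier_injective (le_antisymm hle hge)]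
    exact L2Subbimodule.Iso.refl _
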